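/- Conventions. A signed permutation of size $n\ge 0$ is a permutation $\tau=\tau_1\cdots\tau_n$ of $[n]$ in which every value carries a sign; for $\varepsilon\in\{+,-\}^n$, $\mathfrak S^{\varepsilon}$ denotes those in which value $i$ has sign $\varepsilon_i$, for all $i$. Let $\mathbb k$ be a field. $\mathrm{FQSym}_\pm$ is the Hopf algebra over $\mathbb k$ with basis $(F_\tau)$ indexed by all signed permutations, with product $F_\tau\cdot F_{\tau'}=\sum_\sigma F_\sigma$, where $\sigma$ runs over the shuffles of the word $\tau$ with the word obtained from $\tau'$ by adding the size of $\tau$ to all values (signs travel with values), and with coproduct $\Delta F_\sigma=\sum_{i=0}^{n}F_{\mathrm{std}(\sigma_1\cdots\sigma_i)}\otimes F_{\mathrm{std}(\sigma_{i+1}\cdots\sigma_n)}$ for $\sigma$ of size $n$, where $\mathrm{std}$ is standardization (signs stay at their positions). For $\varepsilon\in\{+,-\}^n$, an $\varepsilon$-Cambrian tree is a directed tree with vertices labeled bijectively by $[n]$ (with additional unlabeled leaves) such that each vertex $v$ with $\varepsilon_v=-$ has one parent and two children, each vertex $v$ with $\varepsilon_v=+$ has one child and two parents, and the two descendant (resp.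 ancestor) subtrees of $v$ are a left one with all labels smaller than $v$ and a right one with all labels larger than $v$. Its reverse, obtained by reversing all arcs, is a $(-\varepsilon)$-Cambrian tree. Two $\varepsilon$-Cambrian trees $T_\circ,T_\bullet$ are twin if the union $U(T_\circ,T_\bullet)$ of $T_\circ$ with the reverse of $T_\bullet$ has no directed cycle. For a directed graph $G$ on $[n]$, $\mathcal L_\varepsilon(G)$ is the set of $\tau\in\mathfrak S^\varepsilon$ in which $i$ appears before $j$ for each arc $i\to j$ of $G$. Let $\mathrm{BaxCamb}$ be the linear span of the elements $\sum_{\tau\in\mathcal L_\varepsilon(U(T_\circ,T_\bullet))}F_\tau$ over all $n\ge 0$, all $\varepsilon\in\{+,-\}^n$ and all pairs $[T_\circ,T_\bullet]$ of twin $\varepsilon$-Cambrian trees. The $\varepsilon$-Cambrian classes are the classes of the equivalence relation on $\mathfrak S^\varepsilon$ generated by $UacVbW\equiv UcaVbW$ if $a<b<c$ and $\varepsilon_b=-$, and $UbVacW\equiv UbVcaW$ if $a<b<c$ and $\varepsilon_b=+$. Below, $(-\varepsilon)$-Cambrian classes are viewed as subsets of $\mathfrak S^{\varepsilon}$ by changing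 all signs. Theorem. (1) $\mathrm{BaxCamb}$ is a Hopf subalgebra of $\mathrm{FQSym}_\pm$: it contains the unit, is closed under the product and the antipode, and satisfies $\Delta(\mathrm{BaxCamb})\subseteq\mathrm{BaxCamb}\otimes\mathrm{BaxCamb}$. (2) For any pair $[T_\circ,T_\bullet]$ of twin $\varepsilon$-Cambrian trees, $\mathcal L_\varepsilon(U(T_\circ,T_\bullet))$ is non-empty and is the intersection of the $\varepsilon$-Cambrian class $\mathcal L_\varepsilon(T_\circ)$ with the $(-\varepsilon)$-Cambrian class of the linear extensions of the reverse of $T_\bullet$. Conversely, every non-empty intersection of an $\varepsilon$-Cambrian class with a $(-\varepsilon)$-Cambrian class is of the form $\mathcal L_\varepsilon(U(T_\circ,T_\bullet))$ for a pair of twin $\varepsilon$-Cambrian trees. -/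

import Mathlib

namespace BaxterCambrian

open scoped TensorProduct

/-- A letter of a signed word: a value together with its sign. -/
abbrev Letter : Type := ℕ × ℤˣ

/-- The values of a signed word, without the signs. -/
def values (w : List Letter) : List ℕ := w.map Prod.fst

/-- A signed permutation, in one-line notation: a word of signed letters whose values are
`0, 1, …, n - 1`, each exactly once, where `n` is the length of the word. -/
@[ext]
structure SignedPerm where
  word : List Letter
  perm : (values word).Perm (List.range word.length)

/-- The words obtained from `w` by adding `n` to all values (signs travel with their values). -/
def shiftWord (n : ℕ) (w : List Letter) : List Letter := w.map fun x => (x.1 + n, x.2)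

/-- The multiset of all shuffles of two words. -/
def shuffle {α : Type*} : List α → List α → Multiset (List α)
  | [], v => {v}
  | u, [] => {u}
  | a :: u, b :: v =>
      (shuffle u (b :: v)).map (List.cons a) + (shuffle (a :: u) v).map (List.cons b)
termination_by u v => u.length + v.length

/-- Standardization of a word with distinct values: each value is replaced by its rank
(the number of smaller values in the word), and the signs stay at their positions. -/
def stdWord (w : List Letter) : List Letter :=
  w.map fun x => ((values w).countP (fun a => decide (a < x.1)), x.2)

section Words

theorem shuffle_nil_left {α : Type*} (v : List α) : shuffle [] v = {v} := by
  cases v <;> simp [shuffle]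

theorem shuffle_nil_right {α : Type*} (u : List α) : shuffle u [] = {u} := by
  cases u <;> simp [shuffle]

theorem shuffle_cons {α : Type*} (a b : α) (u v : List α) :
    shuffle (a :: u) (b :: v) =
      (shuffle u (b :: v)).map (List.cons a) + (shuffle (a :: u) v).map (List.cons b) := by
  rw [shuffle]

theorem perm_of_mem_shuffle {α : Type*} (u v w : List α) (h : w ∈ shuffle u v) :
    w.Perm (u ++ v) := by
  induction u generalizing v w with
  | nil => simp_all [shuffle_nil_left]
  | cons a u ih =>
    induction v generalizing w with
    | nil => simp_all [shuffle_nil_right]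
    | cons b v ih' =>
      simp only [shuffle_cons, Multiset.mem_add, Multiset.mem_map] at h
      rcases h with ⟨x, hx, rfl⟩ | ⟨x, hx, rfl⟩
      · exact (ih _ _ hx).cons a
      · exact ((ih' _ hx).cons b).trans (List.perm_middle (l₁ := a :: u)).symm

theorem nodup_shuffle {α : Type*} (u v : List α) (h : (u ++ v).Nodup) :
    (shuffle u v).Nodup := by
  induction u generalizing v with
  | nil => simp [shuffle_nil_left]
  | cons a u ih =>
    induction v with
    | nil => simp [shuffle_nil_right]
    | cons b v ih' =>
      rw [shuffle_cons, Multiset.nodup_add]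
      refine ⟨(ih _ (by simp_all)).map (List.cons_injective),
        (ih' (by simp_all [List.nodup_append])).map (List.cons_injective), ?_⟩
      rw [Multiset.disjoint_left]
      rintro x hx hx'
      simp only [Multiset.mem_map] at hx hx'
      obtain ⟨y, -, rfl⟩ := hx
      obtain ⟨z, -, hz⟩ := hx'
      have : b = a := by simpa using (List.cons.inj hz).1
      subst this
      simp at h

theorem shuffle_map {α β : Type*} (f : α → β) (u v : List α) :
    shuffle (u.map f) (v.map f) = (shuffle u v).map (List.map f) := by
  induction u generalizing v with
  | nil => simp [shuffle_nil_left]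
  | cons a u ih =>
    induction v with
    | nil => simp [shuffle_nil_right]
    | cons b v ih' =>
      have h1 := ih (b :: v)
      simp only [List.map_cons] at h1 ih'
      simp only [List.map_cons, shuffle_cons, Multiset.map_add, Multiset.map_map, h1, ih']
      rfl

theorem bind_pure_eq {α : Type*} (m : Multiset α) : (m.bind fun a => {a}) = m := by
  simpa using Multiset.bind_singleton m id

theorem shuffle_assoc {α : Type*} (u v w : List α) :
    (shuffle u v).bind (fun x => shuffle x w) = (shuffle v w).bind (fun y => shuffle u y) := by
  induction u generalizing v w with
  | nil => simp [shuffle_nil_left, bind_pure_eq]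
  | cons a u ih =>
    induction v generalizing w with
    | nil => simp [shuffle_nil_right, shuffle_nil_left]
    | cons b v ih' =>
      induction w with
      | nil => simp [shuffle_nil_right, bind_pure_eq]
      | cons c w ih'' =>
        have h1 := congrArg (Multiset.map (List.cons a)) (ih (b :: v) (c :: w))
        have h2 := congrArg (Multiset.map (List.cons b)) (ih' (c :: w))
        have h3 := congrArg (Multiset.map (List.cons c)) ih''
        simp only [shuffle_cons, Multiset.add_bind, Multiset.bind_map, Multiset.bind_add,
          Multiset.map_bind, Multiset.map_add] at h1 h2 h3 ⊢
        rw [h1, ← h2, ← h3]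
        abel

/-- All ways to cut a word into a prefix and a suffix. -/
def splits {α : Type*} : List α → Multiset (List α × List α)
  | [] => {([], [])}
  | a :: u => ([], a :: u) ::ₘ (splits u).map (fun p => (a :: p.1, p.2))

theorem splits_eq {α : Type*} (u : List α) :
    splits u = (Multiset.range (u.length + 1)).map (fun i => (u.take i, u.drop i)) := by
  induction u with
  | nil => simp [splits]
  | cons a u ih =>
    rw [splits, ih]
    simp only [← Multiset.coe_range, Multiset.map_coe, List.length_cons]
    rw [List.range_succ_eq_map (n := u.length + 1)]
    simp only [List.map_cons, List.map_map, ← Multiset.cons_coe]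
    rfl

theorem splits_coassoc {α : Type*} (u : List α) :
    (splits u).bind (fun p => (splits p.1).map fun q => (q.1, q.2, p.2)) =
      (splits u).bind (fun p => (splits p.2).map fun q => (p.1, q.1, q.2)) := by
  induction u with
  | nil => simp [splits]
  | cons a u ih =>
    have h := congrArg (Multiset.map fun x : List α × List α × List α => (a :: x.1, x.2)) ih
    simp only [Multiset.map_bind, Multiset.map_map, Function.comp_def] at h
    simp only [splits, Multiset.cons_bind, Multiset.map_cons, Multiset.map_map, Multiset.bind_map,
      Function.comp_def, Multiset.bind_cons, h, Multiset.map_singleton, Multiset.singleton_add,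
      Multiset.cons_add]

theorem splits_shuffle {α : Type*} (u v : List α) :
    (shuffle u v).bind splits =
      (splits u).bind fun p => (splits v).bind fun q =>
        (shuffle p.1 q.1).bind fun x => (shuffle p.2 q.2).map fun y => (x, y) := by
  induction u generalizing v with
  | nil => simp [shuffle_nil_left, splits, bind_pure_eq]
  | cons a u ih =>
    induction v with
    | nil => simp [shuffle_nil_right, splits, bind_pure_eq]
    | cons b v ih' =>
      have h1 := congrArg (Multiset.map fun x : List α × List α => (a :: x.1, x.2)) (ih (b :: v))
      have h2 := congrArg (Multiset.map fun x : List α × List α => (b :: x.1, x.2)) ih'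
      simp only [splits, shuffle_cons, Multiset.add_bind, Multiset.bind_map, Multiset.bind_add,
        Multiset.map_bind, Multiset.map_add, Multiset.cons_bind, Multiset.bind_cons,
        Multiset.map_map, Function.comp_def, shuffle_nil_left, shuffle_nil_right,
        Multiset.singleton_bind] at h1 h2 ⊢
      rw [h1, h2]
      abel

theorem values_map (f : ℕ → ℕ) (w : List Letter) :
    values (w.map fun x => (f x.1, x.2)) = (values w).map f := by
  simp [values]

theorem length_values (w : List Letter) : (values w).length = w.length := by simp [values]

theorem length_stdWord (w : List Letter) : (stdWord w).length = w.length := by simp [stdWord]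

theorem countP_lt_countP (l : List ℕ) {a b : ℕ} (ha : a ∈ l) (hab : a < b) :
    l.countP (fun x => decide (x < a)) < l.countP (fun x => decide (x < b)) := by
  have h1 : l.countP (fun x => decide (x < b)) =
      l.countP (fun x => decide (x < a)) + l.countP (fun x => decide (a ≤ x ∧ x < b)) := by
    clear ha
    induction l with
    | nil => simp
    | cons c l ih =>
      simp only [List.countP_cons, ih, decide_eq_true_eq]
      split_ifs <;> omega
  have h2 : 0 < l.countP (fun x => decide (a ≤ x ∧ x < b)) :=
    List.countP_pos_iff.2 ⟨a, ha, by simpa using hab⟩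
  omega

theorem stdWord_perm (w : List Letter) (h : (values w).Nodup) :
    (values (stdWord w)).Perm (List.range (stdWord w).length) := by
  have hv : values (stdWord w) =
      (values w).map (fun b => (values w).countP (fun a => decide (a < b))) := by
    simp [values, stdWord]
  have hnd : (values (stdWord w)).Nodup := by
    rw [hv]
    refine List.Nodup.map_on ?_ h
    intro x hx y hy hxy
    rcases lt_trichotomy x y with hlt | heq | hlt
    · exact absurd hxy (countP_lt_countP _ hx hlt).ne
    · exact heq
    · exact absurd hxy (countP_lt_countP _ hy hlt).ne'
  have hsub : values (stdWord w) ⊆ List.range (stdWord w).length := by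
    intro x hx
    rw [hv, List.mem_map] at hx
    obtain ⟨b, hb, rfl⟩ := hx
    rw [List.mem_range, length_stdWord, ← length_values]
    exact List.countP_lt_length_iff.2 ⟨b, hb, by simp⟩
  exact (hnd.subperm hsub).perm_of_length_le (by simp [length_values])

/-- The standardization of a word with distinct values, as a signed permutation. -/
def std (w : List Letter) (h : (values w).Nodup) : SignedPerm := ⟨stdWord w, stdWord_perm w h⟩

theorem countP_range (n x : ℕ) (hx : x ≤ n) :
    (List.range n).countP (fun a => decide (a < x)) = x := by
  induction n with
  | zero => simp at hx; simp [hx]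
  | succ n ih =>
    rw [List.range_succ, List.countP_append]
    rcases Nat.lt_or_ge n x with h | h
    · have : x = n + 1 := by omega
      subst this
      have h2 : (List.range n).countP (fun a => decide (a < n + 1)) = n := by
        conv_rhs => rw [← List.length_range (n := n)]
        rw [List.countP_eq_length]
        intro a ha
        have := List.mem_range.1 ha
        simp; omega
      rw [h2]; simp
    · rw [ih h]; simp; omega

namespace SignedPerm

/-- The size of a signed permutation. -/
def size (σ : SignedPerm) : ℕ := σ.word.length

theorem nodup (σ : SignedPerm) : (values σ.word).Nodup :=
  σ.perm.nodup_iff.2 List.nodup_range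

theorem lt_size (σ : SignedPerm) {a : ℕ} (h : a ∈ values σ.word) : a < σ.size :=
  List.mem_range.1 (σ.perm.subset h)

theorem stdWord_word (σ : SignedPerm) : stdWord σ.word = σ.word := by
  unfold stdWord
  conv_rhs => rw [← List.map_id σ.word]
  refine List.map_congr_left fun x hx => ?_
  have hx' := σ.lt_size (List.mem_map_of_mem (f := Prod.fst) hx)
  rw [σ.perm.countP_eq, countP_range σ.word.length x.1 hx'.le]
  rfl

/-- The standardization of the first `i` letters of `σ`. -/
def take (σ : SignedPerm) (i : ℕ) : SignedPerm :=
  std (σ.word.take i) (σ.nodup.sublist ((List.take_sublist i σ.word).map _))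

/-- The standardization of the letters of `σ` after the first `i` ones. -/
def drop (σ : SignedPerm) (i : ℕ) : SignedPerm :=
  std (σ.word.drop i) (σ.nodup.sublist ((List.drop_sublist i σ.word).map _))

/-- The signed permutation of size `0`. -/
def empty : SignedPerm := ⟨[], by simp [values]⟩

theorem size_take (σ : SignedPerm) (i : ℕ) : (σ.take i).size = min i σ.size := by
  simp [size, take, std, length_stdWord]

theorem size_drop (σ : SignedPerm) (i : ℕ) : (σ.drop i).size = σ.size - i := by
  simp [size, drop, std, length_stdWord]

theorem eq_empty_of_size (σ : SignedPerm) (h : σ.size = 0) : σ = empty :=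
  SignedPerm.ext (List.length_eq_zero_iff.1 h)

theorem take_size (σ : SignedPerm) : σ.take σ.size = σ := by
  refine SignedPerm.ext ?_
  change stdWord (σ.word.take σ.word.length) = σ.word
  rw [List.take_length, σ.stdWord_word]

theorem drop_zero (σ : SignedPerm) : σ.drop 0 = σ := by
  refine SignedPerm.ext ?_
  change stdWord (σ.word.drop 0) = σ.word
  rw [List.drop_zero, σ.stdWord_word]

theorem take_zero (σ : SignedPerm) : σ.take 0 = empty :=
  eq_empty_of_size _ (by simp [size_take])

theorem drop_size (σ : SignedPerm) : σ.drop σ.size = empty :=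
  eq_empty_of_size _ (by simp [size_drop])

theorem values_shift (n : ℕ) (w : List Letter) :
    values (shiftWord n w) = (values w).map (· + n) := values_map (· + n) w

theorem shuffle_perm (σ τ : SignedPerm) {w : List Letter}
    (h : w ∈ shuffle σ.word (shiftWord σ.size τ.word)) :
    (values w).Perm (List.range w.length) := by
  have hp := perm_of_mem_shuffle _ _ _ h
  have h1 : (values w).Perm (values σ.word ++ (values τ.word).map (· + σ.size)) := by
    rw [← values_shift]
    simpa [values] using hp.map Prod.fst
  have h2 : w.length = σ.word.length + τ.word.length := by
    simpa [shiftWord] using hp.length_eq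
  refine h1.trans ((σ.perm.append (τ.perm.map _)).trans ?_)
  rw [h2, List.range_add]
  simp [size, Nat.add_comm]

theorem nodup_append_shift (σ τ : SignedPerm) :
    (values (σ.word ++ shiftWord σ.size τ.word)).Nodup := by
  have h1 : values (σ.word ++ shiftWord σ.size τ.word) =
      values σ.word ++ (values τ.word).map (· + σ.size) := by
    rw [← values_shift]; simp [values]
  rw [h1, List.nodup_append]
  refine ⟨σ.nodup, τ.nodup.map (add_left_injective _), ?_⟩
  intro a ha b hb hab
  have := σ.lt_size ha
  obtain ⟨c, -, rfl⟩ := List.mem_map.1 hb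
  omega

/-- The signed shifted shuffle of `σ` and `τ`: all shuffles of the word `σ` with the word obtained
from `τ` by adding the size of `σ` to all values, where signs travel with their values. -/
def shiftedShuffle (σ τ : SignedPerm) : Finset SignedPerm :=
  ⟨(shuffle σ.word (shiftWord σ.size τ.word)).pmap SignedPerm.mk fun _ => σ.shuffle_perm τ,
    Multiset.Nodup.pmap (fun _ _ _ _ h => congrArg SignedPerm.word h)
      (nodup_shuffle _ _ (σ.nodup_append_shift τ).of_map)⟩

end SignedPerm

theorem stdWord_map_of_strictMonoOn (w : List Letter) (f : ℕ → ℕ)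
    (hf : StrictMonoOn f {a | a ∈ values w}) :
    stdWord (w.map fun x => (f x.1, x.2)) = stdWord w := by
  unfold stdWord
  rw [values_map, List.map_map]
  refine List.map_congr_left fun x hx => ?_
  have hx' : x.1 ∈ values w := List.mem_map_of_mem hx
  simp only [Function.comp_apply, List.countP_map, Prod.mk.injEq, and_true]
  refine List.countP_congr fun a ha => ?_
  simpa using hf.lt_iff_lt (a := a) (b := x.1) ha hx'

end Words

/-- The vector space with basis `F σ`, for all signed permutations `σ`. -/
def FQSym (k : Type*) [CommRing k] : Type _ := SignedPerm →₀ k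

namespace FQSym

variable {k : Type*} [CommRing k]

noncomputable instance : AddCommGroup (FQSym k) := inferInstanceAs (AddCommGroup (SignedPerm →₀ k))

noncomputable instance : Module k (FQSym k) := inferInstanceAs (Module k (SignedPerm →₀ k))

variable (k) in
/-- The basis element `F σ`. -/
noncomputable def F (σ : SignedPerm) : FQSym k := Finsupp.single σ 1

/-- The linear map with prescribed values on the basis `F`. -/
noncomputable def lift {M : Type*} [AddCommGroup M] [Module k M] (f : SignedPerm → M) :
    FQSym k →ₗ[k] M :=
  (Finsupp.linearCombination k f : (SignedPerm →₀ k) →ₗ[k] M)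

@[simp]
theorem lift_F {M : Type*} [AddCommGroup M] [Module k M] (f : SignedPerm → M) (σ : SignedPerm) :
    lift f (F k σ) = f σ := by
  exact (Finsupp.linearCombination_single k 1 σ).trans (one_smul k _)

theorem hom_ext {M : Type*} [AddCommGroup M] [Module k M] {f g : FQSym k →ₗ[k] M}
    (h : ∀ σ, f (F k σ) = g (F k σ)) : f = g :=
  Finsupp.lhom_ext' fun σ => LinearMap.ext_ring (h σ)

/-- The product `F σ * F τ = ∑ F ρ`, over `ρ` in the signed shifted shuffle of `σ` and `τ`. -/
noncomputable def mulMap : FQSym k →ₗ[k] FQSym k →ₗ[k] FQSym k :=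
  lift fun σ => lift fun τ => ∑ ρ ∈ σ.shiftedShuffle τ, F k ρ

/-- The coproduct `Δ (F σ) = ∑ F τ ⊗ F τ'`, over all pairs `(τ, τ')` having `σ` in their signed
convolution, that is, such that `τ` and `τ'` are the standardizations of a prefix of `σ`
and of the complementary suffix. -/
noncomputable def comulMap : FQSym k →ₗ[k] FQSym k ⊗[k] FQSym k :=
  lift fun σ => ∑ i ∈ Finset.range (σ.size + 1), F k (σ.take i) ⊗ₜ[k] F k (σ.drop i)

/-- The counit: the coefficient of the basis element of the empty signed permutation. -/
noncomputable def counitMap : FQSym k →ₗ[k] k :=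
  lift fun σ => if σ.size = 0 then 1 else 0

variable (k) in
/-- The basis element of the standardization of a word with distinct values. -/
noncomputable def ofWord (w : List Letter) : FQSym k :=
  if h : (values w).Nodup then F k (std w h) else 0

theorem ofWord_word (σ : SignedPerm) : ofWord k σ.word = F k σ := by
  rw [ofWord, dif_pos σ.nodup]
  congr 1
  exact SignedPerm.ext σ.stdWord_word

theorem ofWord_eq {u v : List Letter} (hu : (values u).Nodup) (hv : (values v).Nodup)
    (h : stdWord u = stdWord v) : ofWord k u = ofWord k v := by
  rw [ofWord, ofWord, dif_pos hu, dif_pos hv]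
  congr 1
  exact SignedPerm.ext h

theorem ofWord_map (w : List Letter) (hw : (values w).Nodup) (f : ℕ → ℕ)
    (hf : StrictMonoOn f {a | a ∈ values w}) :
    ofWord k (w.map fun x => (f x.1, x.2)) = ofWord k w := by
  refine ofWord_eq ?_ hw (stdWord_map_of_strictMonoOn w f hf)
  rw [values_map]
  exact List.Nodup.map_on (fun a ha b hb => hf.injOn.eq_iff ha hb |>.1) hw

theorem mulMap_F (σ τ : SignedPerm) :
    mulMap (F k σ) (F k τ) =
      ((shuffle σ.word (shiftWord σ.size τ.word)).map (ofWord k)).sum := by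
  simp only [mulMap, lift_F]
  rw [Finset.sum, SignedPerm.shiftedShuffle]
  simp only [Multiset.map_pmap]
  rw [Multiset.pmap_congr (g := fun w _ => ofWord k w) (H₂ := fun _ => σ.shuffle_perm τ),
    Multiset.pmap_eq_map]
  intro w hw h1 h2
  exact (ofWord_word ⟨w, h1⟩).symm

/-- If all values of `u` are smaller than those of `v`, the product of the standardizations of
`u` and `v` is obtained by shuffling `u` and `v`. -/
theorem mulMap_ofWord (u v : List Letter) (h : (values (u ++ v)).Nodup)
    (huv : ∀ a ∈ values u, ∀ b ∈ values v, a < b) :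
    mulMap (ofWord k u) (ofWord k v) = ((shuffle u v).map (ofWord k)).sum := by
  have happ : values (u ++ v) = values u ++ values v := by simp [values]
  have hu : (values u).Nodup := by rw [happ] at h; exact h.of_append_left
  have hv : (values v).Nodup := by rw [happ] at h; exact h.of_append_right
  rw [ofWord, ofWord, dif_pos hu, dif_pos hv, mulMap_F]
  set f : ℕ → ℕ := fun b => if b ∈ values u then (values u).countP (fun a => decide (a < b))
    else (values v).countP (fun a => decide (a < b)) + u.length with hf
  have hfu : (std u hu).word = u.map fun x => (f x.1, x.2) := by
    refine List.map_congr_left fun x hx => ?_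
    have hx' : x.1 ∈ values u := List.mem_map_of_mem hx
    simp [hf, hx']
  have hfv : shiftWord (std u hu).size (std v hv).word = v.map fun x => (f x.1, x.2) := by
    simp only [shiftWord, std, stdWord, List.map_map]
    refine List.map_congr_left fun x hx => ?_
    have hx' : x.1 ∈ values v := List.mem_map_of_mem hx
    have : x.1 ∉ values u := fun h' => (huv _ h' _ hx').false
    simp [hf, this, SignedPerm.size]
  rw [hfu, hfv, shuffle_map, Multiset.map_map]
  congr 1
  refine Multiset.map_congr rfl fun w hw => ?_
  have hp : (values w).Perm (values u ++ values v) := by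
    simpa [values] using (perm_of_mem_shuffle _ _ _ hw).map Prod.fst
  refine ofWord_map w (hp.nodup_iff.2 (happ ▸ h)) f ?_
  intro a ha b hb hab
  have ha' := List.mem_append.1 (hp.subset ha)
  have hb' := List.mem_append.1 (hp.subset hb)
  by_cases hau : a ∈ values u <;> by_cases hbu : b ∈ values u
  · simpa [hf, hau, hbu] using countP_lt_countP _ hau hab
  · have h1 : (values u).countP (fun x => decide (x < a)) < (values u).length :=
      List.countP_lt_length_iff.2 ⟨a, hau, by simp⟩
    rw [length_values] at h1
    simp only [hf, hau, hbu, if_true, if_false]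
    omega
  · have := huv b hbu a (ha'.resolve_left hau)
    omega
  · simpa [hf, hau, hbu] using countP_lt_countP _ (ha'.resolve_left hau) hab

theorem nodup_append_of_lt {u v : List Letter} (hu : (values u).Nodup) (hv : (values v).Nodup)
    (huv : ∀ a ∈ values u, ∀ b ∈ values v, a < b) : (values (u ++ v)).Nodup := by
  have happ : values (u ++ v) = values u ++ values v := by simp [values]
  rw [happ, List.nodup_append]
  exact ⟨hu, hv, fun a ha b hb => (huv a ha b hb).ne⟩

theorem mem_values_of_mem_shuffle {u v w : List Letter} (hw : w ∈ shuffle u v) {a : ℕ} :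
    a ∈ values w ↔ a ∈ values u ∨ a ∈ values v := by
  have hp : (values w).Perm (values u ++ values v) := by
    simpa [values] using (perm_of_mem_shuffle _ _ _ hw).map Prod.fst
  rw [hp.mem_iff, List.mem_append]

theorem nodup_of_mem_shuffle {u v w : List Letter} (hw : w ∈ shuffle u v)
    (h : (values (u ++ v)).Nodup) : (values w).Nodup := by
  have hp : (values w).Perm (values (u ++ v)) := (perm_of_mem_shuffle _ _ _ hw).map Prod.fst
  exact hp.nodup_iff.2 h

theorem ofWord_shift (n : ℕ) (w : List Letter) (hw : (values w).Nodup) :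
    ofWord k (shiftWord n w) = ofWord k w :=
  ofWord_map w hw (· + n) (fun _ _ _ _ h => Nat.add_lt_add_right h n)

theorem nodup_shift (n : ℕ) (w : List Letter) (hw : (values w).Nodup) :
    (values (shiftWord n w)).Nodup := by
  rw [SignedPerm.values_shift]
  exact hw.map (add_left_injective _)

theorem lt_shift (σ : SignedPerm) (w : List Letter) (n : ℕ) (hn : σ.size ≤ n) :
    ∀ a ∈ values σ.word, ∀ b ∈ values (shiftWord n w), a < b := by
  intro a ha b hb
  rw [SignedPerm.values_shift] at hb
  obtain ⟨c, -, rfl⟩ := List.mem_map.1 hb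
  have := σ.lt_size ha
  omega

theorem mulMap_assoc_word (u v w : List Letter) (hu : (values u).Nodup) (hv : (values v).Nodup)
    (hw : (values w).Nodup) (huv : ∀ a ∈ values u, ∀ b ∈ values v, a < b)
    (huw : ∀ a ∈ values u, ∀ b ∈ values w, a < b) (hvw : ∀ a ∈ values v, ∀ b ∈ values w, a < b) :
    mulMap (mulMap (ofWord k u) (ofWord k v)) (ofWord k w) =
      mulMap (ofWord k u) (mulMap (ofWord k v) (ofWord k w)) := by
  have huv' := nodup_append_of_lt hu hv huv
  have hvw' := nodup_append_of_lt hv hw hvw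
  rw [mulMap_ofWord u v huv' huv, mulMap_ofWord v w hvw' hvw, ← LinearMap.flip_apply mulMap,
    map_multiset_sum, map_multiset_sum, Multiset.map_map, Multiset.map_map]
  have h1 : ∀ x ∈ shuffle u v, (mulMap.flip (ofWord k w) ∘ ofWord k) x =
      ((shuffle x w).map (ofWord k)).sum := by
    intro x hx
    have hxw : ∀ a ∈ values x, ∀ b ∈ values w, a < b := fun a ha b hb =>
      ((mem_values_of_mem_shuffle hx).1 ha).elim (huw a · b hb) (hvw a · b hb)
    exact mulMap_ofWord x w (nodup_append_of_lt (nodup_of_mem_shuffle hx huv') hw hxw) hxw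
  have h2 : ∀ y ∈ shuffle v w, (mulMap (ofWord k u) ∘ ofWord k) y =
      ((shuffle u y).map (ofWord k)).sum := by
    intro y hy
    have huy : ∀ a ∈ values u, ∀ b ∈ values y, a < b := fun a ha b hb =>
      ((mem_values_of_mem_shuffle hy).1 hb).elim (huv a ha b) (huw a ha b)
    exact mulMap_ofWord u y (nodup_append_of_lt hu (nodup_of_mem_shuffle hy hvw') huy) huy
  rw [Multiset.map_congr rfl h1, Multiset.map_congr rfl h2, ← Multiset.sum_bind,
    ← Multiset.sum_bind, ← Multiset.map_bind, ← Multiset.map_bind, shuffle_assoc]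

theorem mulMap_assoc (x y z : FQSym k) : mulMap (mulMap x y) z = mulMap x (mulMap y z) := by
  have key : (mulMap (k := k)).compr₂ mulMap = (LinearMap.lcomp k _ (mulMap (k := k)) ∘ₗ
      LinearMap.llcomp k _ _ _).flip.flip ∘ₗ mulMap := by
    refine hom_ext fun σ => hom_ext fun τ => hom_ext fun ρ => ?_
    change mulMap (mulMap (F k σ) (F k τ)) (F k ρ) = mulMap (F k σ) (mulMap (F k τ) (F k ρ))
    rw [← ofWord_word σ, ← ofWord_word τ, ← ofWord_word ρ, ← ofWord_shift σ.size τ.word τ.nodup,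
      ← ofWord_shift (σ.size + τ.size) ρ.word ρ.nodup]
    refine mulMap_assoc_word _ _ _ σ.nodup (nodup_shift _ _ τ.nodup) (nodup_shift _ _ ρ.nodup)
      (lt_shift σ _ _ le_rfl) (lt_shift σ _ _ (by omega)) ?_
    intro a ha b hb
    rw [SignedPerm.values_shift] at ha hb
    obtain ⟨c, hc, rfl⟩ := List.mem_map.1 ha
    obtain ⟨d, -, rfl⟩ := List.mem_map.1 hb
    have := τ.lt_size hc
    omega
  exact congr($key x y z)

theorem mulMap_one_left (x : FQSym k) : mulMap (F k SignedPerm.empty) x = x := by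
  have key : mulMap (F k SignedPerm.empty) = LinearMap.id := by
    refine hom_ext fun σ => ?_
    rw [mulMap_F]
    simp [SignedPerm.empty, SignedPerm.size, shiftWord, shuffle_nil_left, ofWord_word]
  exact congr($key x)

theorem mulMap_one_right (x : FQSym k) : mulMap x (F k SignedPerm.empty) = x := by
  have key : mulMap.flip (F k SignedPerm.empty) = LinearMap.id := by
    refine hom_ext fun σ => ?_
    rw [LinearMap.flip_apply, mulMap_F]
    simp [SignedPerm.empty, shiftWord, shuffle_nil_right, ofWord_word]
  exact congr($key x)

noncomputable instance : Ring (FQSym k) :=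
  { (inferInstance : AddCommGroup (FQSym k)) with
    mul := fun x y => mulMap x y
    one := F k SignedPerm.empty
    left_distrib := fun x y z => map_add (mulMap x) y z
    right_distrib := fun x y z => congr($(map_add mulMap x y) z)
    zero_mul := fun x => congr($(map_zero mulMap) x)
    mul_zero := fun x => map_zero (mulMap x)
    mul_assoc := mulMap_assoc
    one_mul := mulMap_one_left
    mul_one := mulMap_one_right }

theorem mul_def (x y : FQSym k) : x * y = mulMap x y := rfl

theorem one_def : (1 : FQSym k) = F k SignedPerm.empty := rfl

noncomputable instance : Algebra k (FQSym k) :=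
  Algebra.ofModule (fun r x y => congr($(map_smul mulMap r x) y))
    (fun r x y => map_smul (mulMap x) r y)

theorem comulMap_F (σ : SignedPerm) : comulMap (F k σ) =
    ((splits σ.word).map fun p => ofWord k p.1 ⊗ₜ[k] ofWord k p.2).sum := by
  rw [splits_eq, Multiset.map_map, comulMap, lift_F, Finset.sum]
  congr 1
  refine Multiset.map_congr rfl fun i _ => ?_
  have h1 : (values (σ.word.take i)).Nodup :=
    σ.nodup.sublist ((List.take_sublist i σ.word).map _)
  have h2 : (values (σ.word.drop i)).Nodup :=
    σ.nodup.sublist ((List.drop_sublist i σ.word).map _)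
  simp only [Function.comp_apply, ofWord, dif_pos h1, dif_pos h2]
  rfl

theorem values_of_mem_splits {α : Type*} {w : List α} {p : List α × List α} (hp : p ∈ splits w) :
    p.1 ++ p.2 = w := by
  rw [splits_eq, Multiset.mem_map] at hp
  obtain ⟨i, -, rfl⟩ := hp
  exact List.take_append_drop i w

theorem splits_map {α β : Type*} (f : α → β) (w : List α) :
    splits (w.map f) = (splits w).map fun p => (p.1.map f, p.2.map f) := by
  simp [splits_eq, List.map_take, List.map_drop]

theorem comulMap_ofWord (w : List Letter) (hw : (values w).Nodup) : comulMap (ofWord k w) =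
    ((splits w).map fun p => ofWord k p.1 ⊗ₜ[k] ofWord k p.2).sum := by
  set f : ℕ → ℕ := fun b => (values w).countP (fun a => decide (a < b)) with hf
  have h1 : (std w hw).word = w.map fun x => (f x.1, x.2) := rfl
  rw [ofWord, dif_pos hw, comulMap_F, h1, splits_map, Multiset.map_map]
  congr 1
  refine Multiset.map_congr rfl fun p hp => ?_
  have hpw := values_of_mem_splits hp
  have happ : values w = values p.1 ++ values p.2 := by rw [← hpw]; simp [values]
  have hmono : StrictMonoOn f {a | a ∈ values w} := fun a ha b _ hab => countP_lt_countP _ ha hab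
  have hnd := happ ▸ hw
  simp only [Function.comp_apply]
  rw [ofWord_map p.1 hnd.of_append_left f
      (hmono.mono fun a ha => happ ▸ List.mem_append_left _ ha),
    ofWord_map p.2 hnd.of_append_right f
      (hmono.mono fun a ha => happ ▸ List.mem_append_right _ ha)]

theorem counitMap_ofWord (w : List Letter) (hw : (values w).Nodup) :
    counitMap (ofWord k w) = if w = [] then 1 else 0 := by
  rw [ofWord, dif_pos hw, counitMap, lift_F]
  simp [SignedPerm.size, std, length_stdWord]

theorem nodup_splits {w : List Letter} {p : List Letter × List Letter} (hp : p ∈ splits w)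
    (hw : (values w).Nodup) : (values p.1).Nodup ∧ (values p.2).Nodup := by
  have happ : values w = values p.1 ++ values p.2 := by
    rw [← values_of_mem_splits hp]; simp [values]
  rw [happ] at hw
  exact ⟨hw.of_append_left, hw.of_append_right⟩

theorem multiset_sum_tmul {M N : Type*} [AddCommGroup M] [AddCommGroup N] [Module k M] [Module k N]
    (s : Multiset M) (n : N) : s.sum ⊗ₜ[k] n = (s.map fun m => m ⊗ₜ[k] n).sum :=
  map_multiset_sum ((TensorProduct.mk k M N).flip n) s

theorem multiset_tmul_sum {M N : Type*} [AddCommGroup M] [AddCommGroup N] [Module k M] [Module k N]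
    (m : M) (s : Multiset N) : m ⊗ₜ[k] s.sum = (s.map fun n => m ⊗ₜ[k] n).sum :=
  map_multiset_sum (TensorProduct.mk k M N m) s

theorem comulMap_coassoc_F (σ : SignedPerm) :
    TensorProduct.assoc k _ _ _ (comulMap.rTensor (FQSym k) (comulMap (F k σ))) =
      comulMap.lTensor (FQSym k) (comulMap (F k σ)) := by
  rw [comulMap_F, map_multiset_sum, map_multiset_sum, map_multiset_sum, Multiset.map_map,
    Multiset.map_map, Multiset.map_map]
  have h1 : ∀ p ∈ splits σ.word, (((TensorProduct.assoc k _ _ _) ∘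
      (comulMap.rTensor (FQSym k))) ∘ fun p => ofWord k p.1 ⊗ₜ[k] ofWord k p.2) p =
      (((splits p.1).map fun q => (q.1, q.2, p.2)).map fun x =>
        ofWord k x.1 ⊗ₜ[k] (ofWord k x.2.1 ⊗ₜ[k] ofWord k x.2.2)).sum := by
    intro p hp
    simp only [Function.comp_apply, LinearMap.rTensor_tmul]
    rw [comulMap_ofWord _ (nodup_splits hp σ.nodup).1, multiset_sum_tmul, map_multiset_sum]
    simp [Multiset.map_map, Function.comp_def]
  have h2 : ∀ p ∈ splits σ.word,
      ((comulMap.lTensor (FQSym k)) ∘ fun p => ofWord k p.1 ⊗ₜ[k] ofWord k p.2) p =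
      (((splits p.2).map fun q => (p.1, q.1, q.2)).map fun x =>
        ofWord k x.1 ⊗ₜ[k] (ofWord k x.2.1 ⊗ₜ[k] ofWord k x.2.2)).sum := by
    intro p hp
    simp only [Function.comp_apply, LinearMap.lTensor_tmul]
    rw [comulMap_ofWord _ (nodup_splits hp σ.nodup).2, multiset_tmul_sum]
    simp [Multiset.map_map]
  rw [Multiset.map_congr rfl h1, Multiset.map_congr rfl h2, ← Multiset.sum_bind,
    ← Multiset.sum_bind, ← Multiset.map_bind, ← Multiset.map_bind, splits_coassoc]

noncomputable instance : Coalgebra k (FQSym k) where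
  comul := comulMap
  counit := counitMap
  coassoc := hom_ext comulMap_coassoc_F
  rTensor_counit_comp_comul := by
    refine hom_ext fun σ => ?_
    simp only [LinearMap.comp_apply, comulMap, lift_F, map_sum, LinearMap.rTensor_tmul, counitMap,
      SignedPerm.size_take]
    rw [Finset.sum_eq_single 0]
    · simp [SignedPerm.drop_zero]
    · intro i hi hi0
      have := Finset.mem_range.1 hi
      rw [if_neg (by omega), TensorProduct.zero_tmul]
    · simp
  lTensor_counit_comp_comul := by
    refine hom_ext fun σ => ?_
    simp only [LinearMap.comp_apply, comulMap, lift_F, map_sum, LinearMap.lTensor_tmul, counitMap,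
      SignedPerm.size_drop]
    rw [Finset.sum_eq_single σ.size]
    · simp [SignedPerm.take_size]
    · intro i hi hi0
      have := Finset.mem_range.1 hi
      rw [if_neg (by omega), TensorProduct.tmul_zero]
    · simp

theorem comulMap_mul_word (u v : List Letter) (hu : (values u).Nodup) (hv : (values v).Nodup)
    (huv : ∀ a ∈ values u, ∀ b ∈ values v, a < b) :
    comulMap (ofWord k u * ofWord k v) = comulMap (ofWord k u) * comulMap (ofWord k v) := by
  have hnd := nodup_append_of_lt hu hv huv
  rw [mul_def, mulMap_ofWord u v hnd huv, map_multiset_sum, Multiset.map_map]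
  have h1 : ∀ w ∈ shuffle u v, (comulMap ∘ ofWord k) w =
      ((splits w).map fun p => ofWord k p.1 ⊗ₜ[k] ofWord k p.2).sum := fun w hw =>
    comulMap_ofWord w (nodup_of_mem_shuffle hw hnd)
  rw [Multiset.map_congr rfl h1, ← Multiset.sum_bind, ← Multiset.map_bind, splits_shuffle,
    Multiset.map_bind, Multiset.sum_bind, comulMap_ofWord u hu, ← Multiset.sum_map_mul_right]
  congr 1
  refine Multiset.map_congr rfl fun p hp => ?_
  rw [Multiset.map_bind, Multiset.sum_bind, comulMap_ofWord v hv, ← Multiset.sum_map_mul_left]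
  congr 1
  refine Multiset.map_congr rfl fun q hq => ?_
  have hpu : values u = values p.1 ++ values p.2 := by
    rw [← values_of_mem_splits hp]; simp [values]
  have hqv : values v = values q.1 ++ values q.2 := by
    rw [← values_of_mem_splits hq]; simp [values]
  have hlt1 : ∀ a ∈ values p.1, ∀ b ∈ values q.1, a < b := fun a ha b hb =>
    huv a (hpu ▸ List.mem_append_left _ ha) b (hqv ▸ List.mem_append_left _ hb)
  have hlt2 : ∀ a ∈ values p.2, ∀ b ∈ values q.2, a < b := fun a ha b hb =>
    huv a (hpu ▸ List.mem_append_right _ ha) b (hqv ▸ List.mem_append_right _ hb)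
  have hp' := nodup_splits hp hu
  have hq' := nodup_splits hq hv
  rw [Algebra.TensorProduct.tmul_mul_tmul, mul_def, mul_def,
    mulMap_ofWord _ _ (nodup_append_of_lt hp'.1 hq'.1 hlt1) hlt1,
    mulMap_ofWord _ _ (nodup_append_of_lt hp'.2 hq'.2 hlt2) hlt2, multiset_sum_tmul,
    Multiset.map_map, Multiset.map_bind, Multiset.sum_bind]
  congr 1
  refine Multiset.map_congr rfl fun x _ => ?_
  rw [Function.comp_apply, multiset_tmul_sum, Multiset.map_map, Multiset.map_map]
  rfl

theorem counitMap_mul_word (u v : List Letter) (hu : (values u).Nodup) (hv : (values v).Nodup)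
    (huv : ∀ a ∈ values u, ∀ b ∈ values v, a < b) :
    counitMap (ofWord k u * ofWord k v) = counitMap (ofWord k u) * counitMap (ofWord k v) := by
  have hnd := nodup_append_of_lt hu hv huv
  rw [mul_def, mulMap_ofWord u v hnd huv, map_multiset_sum, Multiset.map_map]
  have h1 : ∀ w ∈ shuffle u v, (counitMap ∘ ofWord k) w = if u ++ v = [] then 1 else 0 := by
    intro w hw
    rw [Function.comp_apply, counitMap_ofWord w (nodup_of_mem_shuffle hw hnd)]
    have := (perm_of_mem_shuffle _ _ _ hw).length_eq
    simp only [← List.length_eq_zero_iff, this]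
  rw [Multiset.map_congr rfl h1, counitMap_ofWord u hu, counitMap_ofWord v hv]
  rcases u with _ | ⟨a, u⟩
  · simp [shuffle_nil_left]
  · simp

/-- A bilinear identity on `FQSym` may be checked on words with separated values. -/
theorem hom_ext_mul {M : Type*} [AddCommGroup M] [Module k M] {f g : FQSym k →ₗ[k] FQSym k →ₗ[k] M}
    (h : ∀ u v : List Letter, (values u).Nodup → (values v).Nodup →
      (∀ a ∈ values u, ∀ b ∈ values v, a < b) →
      f (ofWord k u) (ofWord k v) = g (ofWord k u) (ofWord k v)) : f = g := by
  refine hom_ext fun σ => hom_ext fun τ => ?_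
  rw [← ofWord_word σ, ← ofWord_word τ, ← ofWord_shift σ.size τ.word τ.nodup]
  exact h _ _ σ.nodup (nodup_shift _ _ τ.nodup) (lt_shift σ _ _ le_rfl)

noncomputable instance : Bialgebra k (FQSym k) where
  counit_one := by
    change counitMap (F k SignedPerm.empty) = 1
    simp [counitMap, SignedPerm.empty, SignedPerm.size]
  mul_compr₂_counit := hom_ext_mul counitMap_mul_word
  comul_one := by
    change comulMap (F k SignedPerm.empty) = _
    have : SignedPerm.empty.size = 0 := rfl
    simp [comulMap, this, SignedPerm.take_zero, SignedPerm.drop_zero,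
      Algebra.TensorProduct.one_def, one_def]
  mul_compr₂_comul := hom_ext_mul comulMap_mul_word

variable (k) in
/-- The antipode on the basis, determined recursively by `∑ S(x₁) x₂ = ε(x)`. -/
noncomputable def antipodeF (σ : SignedPerm) : FQSym k :=
  if σ.size = 0 then 1
  else -∑ i : Fin σ.size, antipodeF (σ.take i) * F k (σ.drop i)
termination_by σ.size
decreasing_by rw [SignedPerm.size_take]; omega

variable (k) in
/-- The right inverse of the identity for convolution, determined recursively by
`∑ x₁ S(x₂) = ε(x)`. It coincides with the antipode. -/
noncomputable def rightAntipodeF (σ : SignedPerm) : FQSym k :=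
  if σ.size = 0 then 1
  else -∑ i : Fin σ.size, F k (σ.take (i + 1)) * rightAntipodeF (σ.drop (i + 1))
termination_by σ.size
decreasing_by rw [SignedPerm.size_drop]; omega

/-- The antipode. -/
noncomputable def antipodeMap : FQSym k →ₗ[k] FQSym k := lift (antipodeF k)

open LinearMap WithConv in
theorem antipode_convMul : toConv (antipodeMap (k := k)) * toConv LinearMap.id = 1 := by
  refine WithConv.ofConv_injective (hom_ext fun σ => ?_)
  change mul' k (FQSym k) (TensorProduct.map antipodeMap LinearMap.id (comulMap (F k σ))) =
    algebraMap k (FQSym k) (counitMap (F k σ))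
  simp only [comulMap, lift_F, map_sum, TensorProduct.map_tmul, mul'_apply, antipodeMap,
    LinearMap.id_apply, counitMap]
  rw [Finset.sum_range_succ, SignedPerm.take_size, SignedPerm.drop_size, ← one_def, mul_one]
  by_cases h : σ.size = 0
  · rw [antipodeF.eq_def k σ, if_pos h, if_pos h, h, Finset.sum_range_zero, zero_add, map_one]
  · rw [antipodeF.eq_def k σ, if_neg h, if_neg h, ← Fin.sum_univ_eq_sum_range
      (fun i => antipodeF k (σ.take i) * F k (σ.drop i)), add_neg_cancel, map_zero]

open LinearMap WithConv in
theorem convMul_rightAntipode :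
    toConv LinearMap.id * toConv (lift (rightAntipodeF k)) = 1 := by
  refine WithConv.ofConv_injective (hom_ext fun σ => ?_)
  change mul' k (FQSym k) (TensorProduct.map LinearMap.id (lift (rightAntipodeF k))
    (comulMap (F k σ))) = algebraMap k (FQSym k) (counitMap (F k σ))
  simp only [comulMap, lift_F, map_sum, TensorProduct.map_tmul, mul'_apply,
    LinearMap.id_apply, counitMap]
  rw [Finset.sum_range_succ', SignedPerm.take_zero, SignedPerm.drop_zero, ← one_def, one_mul]
  by_cases h : σ.size = 0
  · rw [rightAntipodeF.eq_def k σ, if_pos h, if_pos h, h, Finset.sum_range_zero, zero_add, map_one]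
  · rw [rightAntipodeF.eq_def k σ, if_neg h, if_neg h, ← Fin.sum_univ_eq_sum_range
      (fun i => F k (σ.take (i + 1)) * rightAntipodeF k (σ.drop (i + 1))), add_neg_cancel, map_zero]

open LinearMap WithConv in
theorem convMul_antipode : toConv LinearMap.id * toConv (antipodeMap (k := k)) = 1 := by
  have h := left_inv_eq_right_inv (antipode_convMul (k := k)) convMul_rightAntipode
  rw [h]
  exact convMul_rightAntipode

noncomputable instance : HopfAlgebra k (FQSym k) where
  antipode := antipodeMap
  mul_antipode_rTensor_comul := congrArg WithConv.ofConv antipode_convMul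
  mul_antipode_lTensor_comul := congrArg WithConv.ofConv convMul_antipode

theorem F_mul_F (σ τ : SignedPerm) : F k σ * F k τ = ∑ ρ ∈ σ.shiftedShuffle τ, F k ρ := by
  simp [mul_def, mulMap]

theorem comul_F (σ : SignedPerm) : Coalgebra.comul (R := k) (F k σ) =
    ∑ i ∈ Finset.range (σ.size + 1), F k (σ.take i) ⊗ₜ[k] F k (σ.drop i) :=
  lift_F _ σ

end FQSym

/-- Hopf subalgebras: subspaces `B` that contain the unit, are closed under the product and the
antipode, and satisfy `Δ B ⊆ B ⊗ B`. -/
structure IsHopfSubalgebra (k : Type*) {A : Type*} [CommRing k] [Ring A] [HopfAlgebra k A]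
    (B : Submodule k A) : Prop where
  one_mem : (1 : A) ∈ B
  mul_mem : ∀ x ∈ B, ∀ y ∈ B, x * y ∈ B
  comul_mem : ∀ x ∈ B,
    Coalgebra.comul (R := k) x ∈ LinearMap.range (TensorProduct.map B.subtype B.subtype)
  antipode_mem : ∀ x ∈ B, HopfAlgebra.antipode k x ∈ B

namespace SignedPerm

/-- `σ` has v-signature `ε`: its size is `n` and the value `i` carries the sign `ε i`. -/
def HasSignature {n : ℕ} (σ : SignedPerm) (ε : Fin n → ℤˣ) : Prop :=
  σ.size = n ∧ ∀ i : Fin n, ((i : ℕ), ε i) ∈ σ.word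

/-- The value `i` appears before the value `j` in the word `σ`. -/
def Before (σ : SignedPerm) (i j : ℕ) : Prop :=
  (values σ.word).idxOf i < (values σ.word).idxOf j

/-- The signed permutation obtained by changing all signs. -/
def neg (σ : SignedPerm) : SignedPerm where
  word := σ.word.map fun x => (x.1, -x.2)
  perm := by simpa [values, Function.comp_def] using σ.perm

theorem finite_hasSignature {n : ℕ} (ε : Fin n → ℤˣ) :
    {σ : SignedPerm | σ.HasSignature ε}.Finite := by
  set L : List Letter := (List.finRange n).map fun i : Fin n => ((i : ℕ), ε i) with hL
  have hfin : {w : List Letter | w ∈ L.permutations}.Finite := List.finite_toSet _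
  refine (hfin.preimage (f := SignedPerm.word) fun σ _ τ _ h => SignedPerm.ext h).subset ?_
  rintro σ ⟨hn, hσ⟩
  have hnd : L.Nodup := (List.nodup_finRange n).map fun i j h =>
    Fin.ext (Prod.ext_iff.1 h).1
  have hsub : L ⊆ σ.word := by
    intro x hx
    obtain ⟨i, -, rfl⟩ := List.mem_map.1 hx
    exact hσ i
  exact List.mem_permutations.2
    ((hnd.subperm hsub).perm_of_length_le (by simp [hL, ← hn, size])).symm

end SignedPerm

section Trees

variable {n : ℕ}

/-- The underlying undirected graph of a directed graph. -/
abbrev underlying (arc : Fin n → Fin n → Prop) : SimpleGraph (Fin n) := SimpleGraph.fromRel arc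

/-- The vertices of the subtree attached to `v` at its neighbor `w`: those that can be reached
from `w` without passing through `v`. -/
def subtreeAt (arc : Fin n → Fin n → Prop) (v w : Fin n) : Set (Fin n) :=
  {u | ∃ p : (underlying arc).Walk w u, v ∉ p.support}

/-- Among the neighbors `N` of `v` there is at most one on the left, whose subtree has only labels
smaller than `v`, and at most one on the right, whose subtree has only labels larger than `v`,
and there is no other one. -/
structure LeftRight (arc : Fin n → Fin n → Prop) (v : Fin n) (N : Set (Fin n)) : Prop where
  side : ∀ w ∈ N, (∀ u ∈ subtreeAt arc v w, u < v) ∨ (∀ u ∈ subtreeAt arc v w, v < u)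
  left : ∀ w ∈ N, ∀ w' ∈ N, w < v → w' < v → w = w'
  right : ∀ w ∈ N, ∀ w' ∈ N, v < w → v < w' → w = w'

/-- An `ε`-Cambrian tree, with vertices identified with their labels; `arc v w` is the arc
`v → w`, so that `v` is a child of `w` and `w` is a parent of `v`. Only the arcs between labeled
vertices are recorded: a vertex of sign `-1` has one parent and two children (left and right), a
vertex of sign `1` has one child and two parents (left and right), where any of them may be
missing, that is, may be an unlabeled leaf. -/
structure CambrianTree (ε : Fin n → ℤˣ) where
  arc : Fin n → Fin n → Prop
  asymm : ∀ v w, arc v w → ¬ arc w v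
  connected : (underlying arc).Preconnected
  acyclic : (underlying arc).IsAcyclic
  parent_of_neg : ∀ v, ε v = -1 → {w | arc v w}.Subsingleton
  children_of_neg : ∀ v, ε v = -1 → LeftRight arc v {w | arc w v}
  child_of_pos : ∀ v, ε v = 1 → {w | arc w v}.Subsingleton
  parents_of_pos : ∀ v, ε v = 1 → LeftRight arc v {w | arc v w}

/-- The signed permutations of signature `ε` that are linear extensions of a directed graph: the
source of each arc appears before its target. -/
def linExt (ε : Fin n → ℤˣ) (arc : Fin n → Fin n → Prop) : Set SignedPerm :=
  {σ | σ.HasSignature ε ∧ ∀ i j : Fin n, arc i j → σ.Before i j}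

theorem finite_linExt (ε : Fin n → ℤˣ) (arc : Fin n → Fin n → Prop) : (linExt ε arc).Finite :=
  (SignedPerm.finite_hasSignature ε).subset fun _ h => h.1

theorem underlying_flip (arc : Fin n → Fin n → Prop) :
    underlying (fun v w => arc w v) = underlying arc := by
  ext v w
  simp [or_comm]

theorem LeftRight.flip {arc : Fin n → Fin n → Prop} {v : Fin n} {N : Set (Fin n)}
    (h : LeftRight arc v N) : LeftRight (fun v w => arc w v) v N where
  side := by
    unfold subtreeAt
    rw [underlying_flip]
    exact h.side
  left := h.left
  right := h.right

namespace CambrianTree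

variable {ε : Fin n → ℤˣ}

/-- The reverse of an `ε`-Cambrian tree, which is a `(-ε)`-Cambrian tree. -/
def reverse (T : CambrianTree ε) : CambrianTree (-ε) where
  arc v w := T.arc w v
  asymm v w h := T.asymm w v h
  connected := by rw [underlying_flip]; exact T.connected
  acyclic := by rw [underlying_flip]; exact T.acyclic
  parent_of_neg v h := T.child_of_pos v (neg_inj.1 h)
  children_of_neg v h := (T.parents_of_pos v (neg_inj.1 h)).flip
  child_of_pos v h := T.parent_of_neg v (neg_eq_iff_eq_neg.1 h)
  parents_of_pos v h := (T.children_of_neg v (neg_eq_iff_eq_neg.1 h)).flip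

/-- The arcs of the union of `T` with the reverse of `T'`. -/
def unionArc (T T' : CambrianTree ε) (i j : Fin n) : Prop := T.arc i j ∨ T'.arc j i

/-- `T` and `T'` are twin: the union of `T` with the reverse of `T'` has no directed cycle. -/
def Twin (T T' : CambrianTree ε) : Prop := ∀ i, ¬ Relation.TransGen (unionArc T T') i i

end CambrianTree

/-- The sum of `F τ` over the linear extensions `τ` of the union of `T` with the reverse
of `T'`. -/
noncomputable def PBax (k : Type*) [CommRing k] {ε : Fin n → ℤˣ} (T T' : CambrianTree ε) :
    FQSym k :=
  ∑ τ ∈ (finite_linExt ε (T.unionArc T')).toFinset, FQSym.F k τ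

end Trees

/-- The span of the elements `PBax k T T'` for all pairs `T, T'` of twin Cambrian trees. -/
noncomputable def BaxCamb (k : Type*) [CommRing k] : Submodule k (FQSym k) :=
  Submodule.span k {x | ∃ (n : ℕ) (ε : Fin n → ℤˣ) (T T' : CambrianTree ε),
    T.Twin T' ∧ x = PBax k T T'}

/-- The rewriting rules of the Cambrian congruence: adjacent letters `a`, `c` may be exchanged if
some letter `b` with `a < b < c` either is negative and appears after them, or is positive and
appears before them. -/
inductive CambrianStep : List Letter → List Letter → Prop
  | neg (U V W : List Letter) (a b c : Letter) (hab : a.1 < b.1) (hbc : b.1 < c.1)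
      (hb : b.2 = -1) :
      CambrianStep (U ++ a :: c :: (V ++ b :: W)) (U ++ c :: a :: (V ++ b :: W))
  | pos (U V W : List Letter) (a b c : Letter) (hab : a.1 < b.1) (hbc : b.1 < c.1)
      (hb : b.2 = 1) :
      CambrianStep (U ++ b :: (V ++ a :: c :: W)) (U ++ b :: (V ++ c :: a :: W))

/-- The Cambrian congruence on signed permutations. -/
def CambrianCongr : SignedPerm → SignedPerm → Prop :=
  Relation.EqvGen fun σ τ => CambrianStep σ.word τ.word

/-- `C` is an `ε`-Cambrian class: an equivalence class of the Cambrian congruence on the signed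
permutations of signature `ε`. -/
def IsCambrianClass {n : ℕ} (ε : Fin n → ℤˣ) (C : Set SignedPerm) : Prop :=
  ∃ τ : SignedPerm, τ.HasSignature ε ∧ C = {σ | CambrianCongr σ τ}

end BaxterCambrian

open BaxterCambrian

/-! The combinatorial core is that the `ε`-Cambrian classes are exactly the sets of linear
extensions of `ε`-Cambrian trees. Three facts give this. Every signed permutation extends some tree
(`exists_tree`). Place the letters at heights given by their positions, draw a vertical wall below
each negative label and above each positive one, and join two labels by an arc when one is the next
label met above the other in a strip bounded by walls. Two such strands never overlap, and each
strand determines a cut of the labels that no other arc crosses. So the arcs form a tree with the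
required left and right subtrees. Rewriting steps preserve linear extensions
(`mem_linExt_of_exchange`). In a tree, a negative label between the values of two adjacent vertices
lies below one of them, and a positive one lies above one of them. Hence two letters that a rule
exchanges are never joined by an arc. Any two linear extensions of a tree are congruent
(`wordCongr_of_mem_linExt`). Two adjacent letters of one that are inverted in the other are
incomparable in the tree, and the path between them has a peak or a valley that is a witness for a
rewriting rule. Bubble sort then applies. The linear extensions of the union of `T` and the reverse
of `T'` are therefore the intersection of two Cambrian classes, that is, one class of `BaxterCongr`.
Acyclicity makes it non-empty, and any common element of two classes produces a twin pair. This is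
the second assertion, and it identifies `BaxCamb k` with the span of the class sums
(`baxCamb_eq_classSpan`). The Hopf structure then needs only that `BaxterCongr` is compatible with
restriction to intervals of values, concatenation and increasing relabelling. Restriction shows that
a product of class sums is a sum over a union of classes. Concatenation and relabelling show that
the coefficients of each homogeneous part of the coproduct are constant on products of classes
(`card_cut_le`). The antipode follows by induction on the size. -/

namespace BaxterCambrian

/-! ### Construction of a Cambrian tree from labels placed at distinct heights. -/

section Strands

variable {n : ℕ}

/-- Between the heights `p` and `q`, the values `l` and `r` bound a vertical strip: `l` and `r` are
walls (or lie outside of the label set) and no label strictly between them is a wall. -/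
def IsStrip (ε : Fin n → ℤˣ) (pos : Fin n → ℤ) (p q l r : ℤ) : Prop :=
  (∀ b : Fin n, ((b : ℤ) = l ∨ (b : ℤ) = r) →
    (ε b = 1 ∧ pos b ≤ p) ∨ (ε b = -1 ∧ q ≤ pos b)) ∧
  ∀ b : Fin n, l < b → b < r → (ε b = -1 ∧ pos b ≤ p) ∨ (ε b = 1 ∧ q ≤ pos b)

/-- There is a strand from `i` to `j` inside the strip bounded by `l` and `r`. -/
structure IsStrand (ε : Fin n → ℤˣ) (pos : Fin n → ℤ) (i j : Fin n) (l r : ℤ) : Prop where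
  lt : pos i < pos j
  neg_one_le : -1 ≤ l
  le_size : r ≤ n
  left_source : l ≤ i
  left_target : l ≤ j
  source_right : i ≤ r
  target_right : j ≤ r
  strip : IsStrip ε pos (pos i) (pos j) l r

/-- The arcs of the Cambrian tree of a placement of the labels at distinct heights. -/
def strandArc (ε : Fin n → ℤˣ) (pos : Fin n → ℤ) (i j : Fin n) : Prop :=
  ∃ l r, IsStrand ε pos i j l r

/-- The labels below the strand bounded by `l` and `r`. -/
def BelowStrip (ε : Fin n → ℤˣ) (l r : ℤ) (b : Fin n) : Prop :=
  (l < b ∧ b < r ∧ ε b = -1) ∨ (b ≤ l ∧ ∃ c : Fin n, (c : ℤ) = l ∧ ε c = 1) ∨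
    (r ≤ b ∧ ∃ c : Fin n, (c : ℤ) = r ∧ ε c = 1)

variable {ε : Fin n → ℤˣ} {pos : Fin n → ℤ}

theorem sign_cases (s : ℤˣ) : (s = 1 ∧ s ≠ -1) ∨ (s = -1 ∧ s ≠ 1) := by
  rcases Int.units_eq_one_or s with h | h <;> subst h <;> decide

/-- Turning the picture upside down exchanges the walls below negative labels with those above
positive labels. This symmetry halves the later arguments. -/
theorem IsStrip.flip {p q l r : ℤ} (h : IsStrip ε pos p q l r) :
    IsStrip (-ε) (-pos) (-q) (-p) l r := by
  refine ⟨fun b hb => ?_, fun b hb hb' => ?_⟩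
  · rcases h.1 b hb with h | h <;> simp [h]
  · rcases h.2 b hb hb' with h | h <;> simp [h]

theorem IsStrand.flip {i j : Fin n} {l r : ℤ} (h : IsStrand ε pos i j l r) :
    IsStrand (-ε) (-pos) j i l r :=
  ⟨by simpa using h.lt, h.neg_one_le, h.le_size, h.left_target, h.left_source, h.target_right,
    h.source_right, h.strip.flip⟩

theorem strandArc_flip {i j : Fin n} :
    strandArc (-ε) (-pos) j i ↔ strandArc ε pos i j := by
  constructor
  · rintro ⟨l, r, h⟩
    exact ⟨l, r, by simpa using h.flip⟩
  · rintro ⟨l, r, h⟩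
    exact ⟨l, r, h.flip⟩

/-- The two height ranges overlap, and at a common height a label cannot both carry a wall and not
carry one: a positive `b` would have `pos b ≤ p < q' ≤ pos b`, a negative one `pos b ≤ p' < q ≤ pos
b`. -/
theorem IsStrip.wall_notMem {p q l r p' q' l' r' : ℤ} (h : IsStrip ε pos p q l r)
    (h' : IsStrip ε pos p' q' l' r') (h1 : p < q') (h2 : p' < q) (b : Fin n)
    (hb : (b : ℤ) = l ∨ (b : ℤ) = r) (hl : l' < b) (hr : b < r') : False := by
  have := sign_cases (ε b)
  rcases h.1 b hb with h3 | h3 <;> rcases h'.2 b hl hr with h4 | h4 <;>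
    simp_all <;> omega

theorem IsStrip.pos_le_or_le {p q l r : ℤ} (h : IsStrip ε pos p q l r) {b : Fin n}
    (hl : l ≤ b) (hr : b ≤ r) : pos b ≤ p ∨ q ≤ pos b := by
  rcases hl.eq_or_lt with hl | hl
  · rcases h.1 b (.inl hl.symm) with h | h <;> simp [h]
  · rcases hr.eq_or_lt with hr | hr
    · rcases h.1 b (.inr hr) with h | h <;> simp [h]
    · rcases h.2 b hl hr with h | h <;> simp [h]

/-- Two strands that overlap, both in height and in values, coincide. -/
theorem IsStrand.eq_of_overlap (hpos : Function.Injective pos) {i j i' j' : Fin n}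
    {l r l' r' : ℤ} (h : IsStrand ε pos i j l r) (h' : IsStrand ε pos i' j' l' r')
    (h1 : pos i < pos j') (h2 : pos i' < pos j) (h3 : l < r') (h4 : l' < r) : i = i' ∧ j = j' := by
  have key : ∀ {i j i' j' : Fin n} {l r l' r' : ℤ}, IsStrand ε pos i j l r →
      IsStrand ε pos i' j' l' r' → pos i < pos j' → pos i' < pos j → l < r' → l' < r →
      l ≤ l' ∧ r' ≤ r := by
    intro i j i' j' l r l' r' h h' h1 h2 h3 h4
    have hw := h.strip.wall_notMem h'.strip h1 h2
    have := h.left_source; have := h.source_right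
    have := h'.neg_one_le; have := h'.le_size
    have := i.isLt
    constructor
    -- If `l' < l`, then `l` exceeds `-1` and is a genuine label rather than a sentinel, so its wall
    -- would stand strictly inside the second strip.
    · by_contra! hc
      exact hw ⟨l.toNat, by omega⟩ (.inl (by simp; omega)) (by simp; omega) (by simp; omega)
    · by_contra! hc
      exact hw ⟨r.toNat, by omega⟩ (.inr (by simp; omega)) (by simp; omega) (by simp; omega)
  obtain ⟨e1, e2⟩ := key h h' h1 h2 h3 h4
  obtain ⟨e3, e4⟩ := key h' h h2 h1 h4 h3
  obtain rfl : l = l' := by omega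
  obtain rfl : r = r' := by omega
  have a1 := h.strip.pos_le_or_le h'.left_source h'.source_right
  have a2 := h.strip.pos_le_or_le h'.left_target h'.target_right
  have a3 := h'.strip.pos_le_or_le h.left_source h.source_right
  have a4 := h'.strip.pos_le_or_le h.left_target h.target_right
  have := h.lt; have := h'.lt
  exact ⟨hpos (by omega), hpos (by omega)⟩

/-- A strand with its source above the target of `s` does not cross the cut below `s`. -/
theorem IsStrand.below_iff_of_le {i j i' j' : Fin n}
    {l r l' r' : ℤ} (h : IsStrand ε pos i j l r) (h' : IsStrand ε pos i' j' l' r')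
    (h1 : pos j ≤ pos i') : BelowStrip ε l r i' ↔ BelowStrip ε l r j' := by
  have hlt := h.lt; have hlt' := h'.lt
  -- The wall above a positive boundary label continues upwards forever, so a strand that starts
  -- higher stays on one side of it.
  have wall : ∀ c : Fin n, ((c : ℤ) = l ∨ (c : ℤ) = r) → ε c = 1 → ((c : ℤ) < i' ∧ (c : ℤ) < j') ∨
      ((i' : ℤ) < c ∧ (j' : ℤ) < c) := by
    intro c hc hc1
    have hs := sign_cases (ε c)
    have hpc : pos c ≤ pos i := by
      rcases h.strip.1 c hc with h | h
      · exact h.2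
      · simp_all
    have : ¬ (l' < c ∧ (c : ℤ) < r') := by
      rintro ⟨h3, h4⟩
      rcases h'.strip.2 c h3 h4 with h5 | h5
      · simp_all
      · omega
    have hi' : (i' : ℤ) ≠ c := by
      intro he
      obtain rfl : i' = c := Fin.ext (by exact_mod_cast he)
      omega
    have hj' : (j' : ℤ) ≠ c := by
      intro he
      obtain rfl : j' = c := Fin.ext (by exact_mod_cast he)
      omega
    have := h'.left_source; have := h'.left_target
    have := h'.source_right; have := h'.target_right
    omega
  -- A label above the strand and strictly inside its strip is positive, hence not on the lower side
  -- of the cut.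
  have inner : ∀ b : Fin n, pos j ≤ pos b → l < b → b < r → ε b = 1 := by
    intro b hb hl hr
    rcases h.strip.2 b hl hr with h3 | h3
    · omega
    · exact h3.1
  have hi' := inner i' h1
  have hj' := inner j' (by omega)
  have s1 := sign_cases (ε i')
  have s2 := sign_cases (ε j')
  have lr : l < r ∨ l = r := by have := h.left_source; have := h.source_right; omega
  have key : ∀ {a b : Fin n}, (l < a → a < r → ε a = 1) → (l < b → b < r → ε b = 1) →
      (∀ c : Fin n, ((c : ℤ) = l ∨ (c : ℤ) = r) → ε c = 1 → ((c : ℤ) < a ∧ (c : ℤ) < b) ∨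
      ((a : ℤ) < c ∧ (b : ℤ) < c)) → BelowStrip ε l r a → BelowStrip ε l r b := by
    intro a b ha hb hc hba
    rcases hba with ⟨h3, h4, h5⟩ | ⟨h3, c, h4, h5⟩ | ⟨h3, c, h4, h5⟩
    · simp [ha h3 h4] at h5
    · refine .inr (.inl ⟨?_, c, h4, h5⟩)
      have := hc c (.inl h4) h5
      omega
    · refine .inr (.inr ⟨?_, c, h4, h5⟩)
      have := hc c (.inr h4) h5
      omega
  exact ⟨key hi' hj' wall, key hj' hi' fun c hc hc1 => (wall c hc hc1).imp And.symm And.symm⟩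

/-- The cut depends on the signs alone: that of `b` inside the strip, that of the nearer wall
outside. Sentinel boundaries make no exception, since no label lies beyond them. Together with
`IsStrand.flip`, this turns facts about the lower side into facts about the upper side. -/
theorem belowStrip_neg {l r : ℤ} (hl : -1 ≤ l) (hr : r ≤ n) (hlr : l < r) (b : Fin n) :
    BelowStrip (-ε) l r b ↔ ¬ BelowStrip ε l r b := by
  have hs := sign_cases (ε b)
  have hb := b.isLt
  have side : ∀ x : ℤ, 0 ≤ x → x < n → ((∃ c : Fin n, (c : ℤ) = x ∧ (-ε) c = 1) ↔
      ¬ ∃ c : Fin n, (c : ℤ) = x ∧ ε c = 1) := by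
    intro x h1 h2
    have he : ∀ s : ℤˣ, (∃ c : Fin n, (c : ℤ) = x ∧ ε c = s) ↔ ε ⟨x.toNat, by omega⟩ = s := by
      intro s
      constructor
      · rintro ⟨c, hc, h⟩
        have : c = ⟨x.toNat, by omega⟩ := Fin.ext (by simp; omega)
        rwa [← this]
      · intro h
        exact ⟨_, by simp; omega, h⟩
    have := sign_cases (ε ⟨x.toNat, by omega⟩)
    rw [he]
    simp only [Pi.neg_apply, neg_eq_iff_eq_neg, he]
    tauto
  have hneg : (-ε) b = -1 ↔ ε b = 1 := by simp
  unfold BelowStrip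
  rcases lt_or_ge l b with h1 | h1
  · rcases lt_or_ge (b : ℤ) r with h2 | h2
    · have h3 : ¬ (b : ℤ) ≤ l := by omega
      have h4 : ¬ r ≤ (b : ℤ) := by omega
      rcases hs with hs | hs <;> simp [h1, h2, h3, h4, hs.1]
    · have h3 : ¬ (b : ℤ) ≤ l := by omega
      have h4 : ¬ (b : ℤ) < r := by omega
      simp only [h2, h3, h4, side r (by omega) (by omega), and_false,
        true_and, false_and, false_or]
  · have h3 : ¬ r ≤ (b : ℤ) := by omega
    have h4 : ¬ l < (b : ℤ) := by omega
    simp only [h1, h3, h4, side l (by omega) (by omega),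
      true_and, false_and, or_false, false_or]

theorem IsStrand.lt_of_strand {i j : Fin n} {l r : ℤ} (h : IsStrand ε pos i j l r) : l < r := by
  have h1 := h.left_source; have h2 := h.left_target
  have h3 := h.source_right; have h4 := h.target_right
  by_contra hc
  have : i = j := Fin.ext (by omega)
  subst this
  exact h.lt.false

theorem IsStrand.below_source {i j : Fin n} {l r : ℤ} (h : IsStrand ε pos i j l r) :
    BelowStrip ε l r i := by
  have hlt := h.lt
  rcases h.left_source.eq_or_lt with h1 | h1
  · rcases h.strip.1 i (.inl h1.symm) with h2 | h2
    · exact .inr (.inl ⟨h1.ge, i, h1.symm, h2.1⟩)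
    · omega
  · rcases h.source_right.eq_or_lt with h3 | h3
    · rcases h.strip.1 i (.inr h3) with h2 | h2
      · exact .inr (.inr ⟨h3.ge, i, h3, h2.1⟩)
      · omega
    · rcases h.strip.2 i h1 h3 with h2 | h2
      · exact .inl ⟨h1, h3, h2.1⟩
      · omega

theorem IsStrand.not_below_target {i j : Fin n} {l r : ℤ} (h : IsStrand ε pos i j l r) :
    ¬ BelowStrip ε l r j :=
  (belowStrip_neg h.neg_one_le h.le_size h.lt_of_strand j).1 h.flip.below_source

/-- Only one arc crosses the cut below a strand. -/
theorem IsStrand.below_iff (hpos : Function.Injective pos) {i j i' j' : Fin n}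
    {l r : ℤ} (h : IsStrand ε pos i j l r) (h' : strandArc ε pos i' j')
    (hne : ¬ (i = i' ∧ j = j')) : BelowStrip ε l r i' ↔ BelowStrip ε l r j' := by
  obtain ⟨l', r', h'⟩ := h'
  have hlr := h.lt_of_strand
  rcases le_or_gt (pos j) (pos i') with h1 | h1
  · exact h.below_iff_of_le h' h1
  rcases le_or_gt (pos j') (pos i) with h2 | h2
  · have := h.flip.below_iff_of_le h'.flip (by simpa using h2)
    rw [belowStrip_neg h.neg_one_le h.le_size hlr, belowStrip_neg h.neg_one_le h.le_size hlr] at this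
    exact (not_iff_not.1 this).symm
  have := h'.left_source; have := h'.left_target
  have := h'.source_right; have := h'.target_right
  -- The remaining strands overlap this one in height. Being distinct from it, they stand beside it,
  -- with both ends beyond the same wall.
  have side : (r' ≤ l) ∨ (r ≤ l') := by
    by_contra! hc
    exact hne (h.eq_of_overlap hpos h' h2 h1 hc.1 hc.2)
  unfold BelowStrip
  rcases side with h3 | h3
  · have a1 : (i' : ℤ) ≤ l := by omega
    have a2 : (j' : ℤ) ≤ l := by omega
    have a3 : ¬ l < (i' : ℤ) := by omega
    have a4 : ¬ l < (j' : ℤ) := by omega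
    have a5 : ¬ r ≤ (i' : ℤ) := by omega
    have a6 : ¬ r ≤ (j' : ℤ) := by omega
    simp only [a1, a2, a3, a4, a5, a6, true_and, false_and, or_false, false_or]
  · have a1 : r ≤ (i' : ℤ) := by omega
    have a2 : r ≤ (j' : ℤ) := by omega
    have a3 : ¬ (i' : ℤ) < r := by omega
    have a4 : ¬ (j' : ℤ) < r := by omega
    have a5 : ¬ (i' : ℤ) ≤ l := by omega
    have a6 : ¬ (j' : ℤ) ≤ l := by omega
    simp only [a1, a2, a3, a4, a5, a6, true_and, false_and, and_false, false_or]

theorem strandArc.asymm {i j : Fin n} (h : strandArc ε pos i j) : ¬ strandArc ε pos j i := by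
  rintro ⟨l', r', h'⟩
  obtain ⟨l, r, h⟩ := h
  exact h.lt.asymm h'.lt

theorem underlying_adj {arc : Fin n → Fin n → Prop} (h : ∀ v w, arc v w → ¬ arc w v)
    {v w : Fin n} : (underlying arc).Adj v w ↔ arc v w ∨ arc w v := by
  rw [SimpleGraph.fromRel_adj]
  refine ⟨fun h => h.2, fun h' => ⟨?_, h'⟩⟩
  rintro rfl
  rcases h' with h' | h' <;> exact h _ _ h' h'

/-- Every arc is a bridge: its ends are on opposite sides of its cut `BelowStrip`, which no other
arc crosses. -/
theorem strandArc_isAcyclic (hpos : Function.Injective pos) :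
    (underlying (strandArc ε pos)).IsAcyclic := by
  have key : ∀ i j, strandArc ε pos i j →
      ¬ ((underlying (strandArc ε pos)) \ SimpleGraph.fromEdgeSet {s(i, j)}).Reachable i j := by
    rintro i j ⟨l, r, h⟩ ⟨p⟩
    have inv : ∀ {u v : Fin n}
        (p : ((underlying (strandArc ε pos)) \ SimpleGraph.fromEdgeSet {s(i, j)}).Walk u v),
        (BelowStrip ε l r u ↔ BelowStrip ε l r v) := by
      intro u v p
      induction p with
      | nil => rfl
      | @cons u v w hadj p ih =>
        rw [← ih]
        rw [SimpleGraph.sdiff_adj, SimpleGraph.fromEdgeSet_adj,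
          underlying_adj fun _ _ => strandArc.asymm] at hadj
        obtain ⟨h1 | h1, h2⟩ := hadj
        · refine h.below_iff hpos h1 ?_
          rintro ⟨rfl, rfl⟩
          obtain ⟨_, _, h3⟩ := h1
          exact h2 ⟨rfl, fun he => h3.lt.ne (congrArg pos he)⟩
        · refine (h.below_iff hpos h1 ?_).symm
          rintro ⟨rfl, rfl⟩
          obtain ⟨_, _, h3⟩ := h1
          exact h2 ⟨Sym2.eq_swap, fun he => h3.lt.ne' (congrArg pos he)⟩
    exact h.not_below_target ((inv p).1 h.below_source)
  rw [SimpleGraph.isAcyclic_iff_forall_adj_isBridge]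
  intro i j hij
  rw [SimpleGraph.isBridge_iff]
  rcases (underlying_adj fun _ _ => strandArc.asymm).1 hij with h | h
  · exact key _ _ h
  · rw [Sym2.eq_swap]
    exact fun hr => key _ _ h hr.symm

/-- A walk that avoids an end of the strand cannot use its arc. This places a whole subtree on one
side of the cut. -/
theorem IsStrand.below_iff_of_walk (hpos : Function.Injective pos) {i j u v x : Fin n} {l r : ℤ}
    (h : IsStrand ε pos i j l r) (hx : x = i ∨ x = j)
    (p : (underlying (strandArc ε pos)).Walk u v) (hp : x ∉ p.support) :
    BelowStrip ε l r u ↔ BelowStrip ε l r v := by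
  induction p with
  | nil => rfl
  | @cons u v w hadj p ih =>
    rw [SimpleGraph.Walk.support_cons, List.mem_cons, not_or] at hp
    rw [← ih hp.2]
    have hv : x ≠ v := fun he => hp.2 (he ▸ p.start_mem_support)
    rcases (underlying_adj fun _ _ => strandArc.asymm).1 hadj with h1 | h1
    · refine h.below_iff hpos h1 ?_
      rintro ⟨rfl, rfl⟩
      exact hx.elim hp.1 hv
    · refine (h.below_iff hpos h1 ?_).symm
      rintro ⟨rfl, rfl⟩
      exact hx.elim hv hp.1

/-- The wall of a negative label hangs below it, so it bounds every strand that arrives there. -/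
theorem IsStrand.target_of_neg {i j : Fin n} {l r : ℤ} (h : IsStrand ε pos i j l r)
    (hj : ε j = -1) : (j : ℤ) = l ∨ (j : ℤ) = r := by
  have h1 := h.left_target; have h2 := h.target_right
  by_contra! hc
  rcases h.strip.2 j (by omega) (by omega) with h3 | h3
  · exact (h.lt.trans_le h3.2).false
  · simp [hj] at h3

/-- A negative label has no wall above it, so it cannot bound a strand that leaves it. -/
theorem IsStrand.source_of_neg {i j : Fin n} {l r : ℤ} (h : IsStrand ε pos i j l r)
    (hi : ε i = -1) : l < i ∧ i < r := by
  have h1 := h.left_source; have h2 := h.source_right; have h4 := h.lt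
  have : ¬ ((i : ℤ) = l ∨ (i : ℤ) = r) := by
    intro hc
    rcases h.strip.1 i hc with h3 | h3
    · simp [hi] at h3
    · omega
  omega

/-- Two strands leaving `v` both have `v` in the interior of their strips, so they overlap just
above `v`. -/
theorem strandArc_parent (hpos : Function.Injective pos) (v : Fin n) (hv : ε v = -1) :
    {w | strandArc ε pos v w}.Subsingleton := by
  rintro w ⟨l, r, h⟩ w' ⟨l', r', h'⟩
  have h1 := h.source_of_neg hv
  have h2 := h'.source_of_neg hv
  exact (h.eq_of_overlap hpos h' h'.lt h.lt (by omega) (by omega)).2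

/-- A strand arriving at `v` is bounded by `v` on one side. As that wall is negative, the lower side
of the cut does not reach past it, so the subtree stays on one side of `v`. Two strands arriving
from the same side overlap just below `v`. -/
theorem strandArc_children (hpos : Function.Injective pos) (v : Fin n) (hv : ε v = -1) :
    LeftRight (strandArc ε pos) v {w | strandArc ε pos w v} where
  side := by
    rintro w ⟨l, r, h⟩
    have hb := h.target_of_neg hv
    have h1 := h.left_source; have h2 := h.source_right; have h3 := h.lt_of_strand
    have key : ∀ u ∈ subtreeAt (strandArc ε pos) v w, BelowStrip ε l r u ∧ u ≠ v := by
      rintro u ⟨p, hp⟩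
      exact ⟨(h.below_iff_of_walk hpos (.inr rfl) p hp).1 h.below_source,
        fun he => hp (he ▸ p.end_mem_support)⟩
    have hvpos : ∀ c : Fin n, (c : ℤ) = v → ε c = 1 → False := by
      intro c hc h1
      obtain rfl : c = v := Fin.ext (by omega)
      simp [hv] at h1
    rcases hb with hb | hb
    · refine .inr fun u hu => ?_
      obtain ⟨h4 | ⟨h4, c, h5, h6⟩ | h4, -⟩ := key u hu
      · rw [Fin.lt_def]; omega
      · exact (hvpos c (by omega) h6).elim
      · rw [Fin.lt_def]; omega
    · refine .inl fun u hu => ?_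
      obtain ⟨h4 | h4 | ⟨h4, c, h5, h6⟩, -⟩ := key u hu
      · rw [Fin.lt_def]; omega
      · rw [Fin.lt_def]; omega
      · exact (hvpos c (by omega) h6).elim
  left := by
    rintro w ⟨l, r, h⟩ w' ⟨l', r', h'⟩ hw hw'
    have h1 := h.target_of_neg hv; have h2 := h'.target_of_neg hv
    have := h.left_source; have := h'.left_source
    rw [Fin.lt_def] at hw hw'
    exact (h.eq_of_overlap hpos h' h.lt h'.lt (by omega) (by omega)).1
  right := by
    rintro w ⟨l, r, h⟩ w' ⟨l', r', h'⟩ hw hw'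
    have h1 := h.target_of_neg hv; have h2 := h'.target_of_neg hv
    have := h.source_right; have := h'.source_right
    rw [Fin.lt_def] at hw hw'
    exact (h.eq_of_overlap hpos h' h.lt h'.lt (by omega) (by omega)).1

/-- If no wall at the height of `i` separates `i` from a higher label `j`, then some strand starting
at `i` ends at the first label met by the strip that contains both. -/
theorem exists_isStrand (i j : Fin n) (hij : pos i < pos j)
    (hw : ∀ b : Fin n, min i j < b → b < max i j →
      (ε b = -1 ∧ pos b ≤ pos i) ∨ (ε b = 1 ∧ pos i < pos b)) :
    ∃ x l r, IsStrand ε pos i x l r ∧ pos x ≤ pos j ∧ l ≤ j ∧ j ≤ r := by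
  -- `W` is the set of walls just above the height of `i`; the strip is bounded by the nearest ones
  -- around `i` and `j`, or by the sentinels `-1` and `n`.
  obtain ⟨W, hW⟩ : ∃ W : ℤ → Prop, ∀ z, W z ↔ ∃ b : Fin n, (b : ℤ) = z ∧
    ((ε b = 1 ∧ pos b ≤ pos i) ∨ (ε b = -1 ∧ pos i < pos b)) := ⟨_, fun _ => Iff.rfl⟩
  let m : ℤ := min (i : ℤ) j
  let M : ℤ := max (i : ℤ) j
  obtain ⟨l, ⟨hlm, hl⟩, hlmax⟩ := Int.exists_greatest_of_bdd
    (P := fun z => z ≤ m ∧ (z = -1 ∨ W z)) ⟨m, fun z hz => hz.1⟩ ⟨-1, by omega, .inl rfl⟩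
  obtain ⟨r, ⟨hrM, hr⟩, hrmin⟩ := Int.exists_least_of_bdd
    (P := fun z => M ≤ z ∧ (z = n ∨ W z)) ⟨M, fun z hz => hz.1⟩ ⟨n, by omega, .inl rfl⟩
  have hl1 : -1 ≤ l := hlmax (-1) ⟨by omega, .inl rfl⟩
  have hrn : r ≤ n := hrmin n ⟨by omega, .inl rfl⟩
  have hin : ∀ b : Fin n, l < b → b < r →
      (ε b = -1 ∧ pos b ≤ pos i) ∨ (ε b = 1 ∧ pos i < pos b) := by
    intro b hb1 hb2
    have hs := sign_cases (ε b)
    by_cases hWb : W b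
    · have h1 : ¬ (b : ℤ) ≤ m := fun h => absurd (hlmax b ⟨h, .inr hWb⟩) (by omega)
      have h2 : ¬ M ≤ (b : ℤ) := fun h => absurd (hrmin b ⟨h, .inr hWb⟩) (by omega)
      exact hw b (by rw [Fin.lt_def]; simp only [Fin.coe_min]; omega)
        (by rw [Fin.lt_def]; simp only [Fin.coe_max]; omega)
    · have h3 : ¬ ((ε b = 1 ∧ pos b ≤ pos i) ∨ (ε b = -1 ∧ pos i < pos b)) :=
        fun h => hWb ((hW b).2 ⟨b, rfl, h⟩)
      rcases hs with hs | hs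
      · exact .inr ⟨hs.1, by by_contra hc; exact h3 (.inl ⟨hs.1, by omega⟩)⟩
      · exact .inl ⟨hs.1, by by_contra hc; exact h3 (.inr ⟨hs.1, by omega⟩)⟩
  -- The strip must be taken closed: a boundary wall may hang from a negative label, which is then a
  -- possible target.
  obtain ⟨x, hx, hxmin⟩ := Finset.exists_min_image
    (Finset.univ.filter fun y : Fin n => l ≤ (y : ℤ) ∧ (y : ℤ) ≤ r ∧ pos i < pos y) pos
    ⟨j, by simp only [Finset.mem_filter, Finset.mem_univ, true_and]; omega⟩
  simp only [Finset.mem_filter, Finset.mem_univ, true_and] at hx hxmin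
  refine ⟨x, l, r, ⟨hx.2.2, hl1, hrn, by omega, hx.1, by omega, hx.2.1, ?_, ?_⟩,
    hxmin j (by omega), by omega, by omega⟩
  · intro b hb
    have hWb : W b := by
      have := b.isLt
      rcases hb with hb | hb
      · exact hb ▸ hl.resolve_left (by omega)
      · exact hb ▸ hr.resolve_left (by omega)
    obtain ⟨c, hc, hc'⟩ := (hW b).1 hWb
    obtain rfl : c = b := Fin.ext (by omega)
    exact hc'.imp id fun h => ⟨h.1, hxmin c (by omega)⟩
  · intro b hb1 hb2
    exact (hin b hb1 hb2).imp id fun h => ⟨h.1, hxmin b (by omega)⟩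

/-- The strand from `i` ends at some `x` in a strip that also contains `j`. The interior of that
strip has no wall just above `x` between `x` and `j`, so the climb can be repeated from `x`. -/
theorem strandArc_reachable (hpos : Function.Injective pos) (i j : Fin n) (hij : pos i < pos j)
    (hw : ∀ b : Fin n, min i j < b → b < max i j →
      (ε b = -1 ∧ pos b ≤ pos i) ∨ (ε b = 1 ∧ pos i < pos b)) :
    (underlying (strandArc ε pos)).Reachable i j := by
  induction h : (pos j - pos i).toNat using Nat.strong_induction_on generalizing i with
  | _ N ih =>
    obtain ⟨x, l, r, hs, hxj, hlj, hjr⟩ := exists_isStrand i j hij hw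
    have hadj : (underlying (strandArc ε pos)).Adj i x :=
      (underlying_adj fun _ _ => strandArc.asymm).2 (.inl ⟨l, r, hs⟩)
    refine hadj.reachable.trans ?_
    rcases hxj.eq_or_lt with he | hlt
    · rw [hpos he]
    · have := hs.lt
      refine ih _ (by omega) x hlt (fun b hb1 hb2 => ?_) rfl
      have h1 := hs.left_target; have h2 := hs.target_right
      rw [Fin.lt_def] at hb1 hb2
      simp only [Fin.coe_min, Fin.coe_max] at hb1 hb2
      refine (hs.strip.2 b (by omega) (by omega)).imp (fun h => ⟨h.1, by omega⟩)
        fun h => ⟨h.1, lt_of_le_of_ne h.2 fun he => ?_⟩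
      have := hpos he
      subst this
      omega

theorem strandArc_preconnected (hpos : Function.Injective pos) :
    (underlying (strandArc ε pos)).Preconnected := by
  -- No label lies between consecutive ones, so the hypothesis about walls is empty.
  have step : ∀ i j : Fin n, (j : ℕ) = i + 1 → (underlying (strandArc ε pos)).Reachable i j := by
    intro i j hij
    have hne : i ≠ j := by rintro rfl; omega
    rcases lt_or_gt_of_ne fun h => hne (hpos h) with h | h
    · refine strandArc_reachable hpos i j h fun b h1 h2 => ?_
      rw [Fin.lt_def] at h1 h2
      simp only [Fin.coe_min, Fin.coe_max] at h1 h2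
      omega
    · refine (strandArc_reachable hpos j i h fun b h1 h2 => ?_).symm
      rw [Fin.lt_def] at h1 h2
      simp only [Fin.coe_min, Fin.coe_max] at h1 h2
      omega
  have up : ∀ (d : ℕ) (i j : Fin n), (j : ℕ) = i + d →
      (underlying (strandArc ε pos)).Reachable i j := by
    intro d
    induction d with
    | zero =>
      intro i j h
      obtain rfl : i = j := Fin.ext (by omega)
      exact .refl _
    | succ d ih =>
      intro i j h
      exact (ih i ⟨i + d, by omega⟩ rfl).trans (step _ _ (by simp; omega))
  intro i j
  rcases le_total (i : ℕ) j with h | h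
  · exact up (j - i) i j (by omega)
  · exact (up (i - j) j i (by omega)).symm

theorem strandArc_flip_eq :
    strandArc (-ε) (-pos) = fun v w => strandArc ε pos w v := by
  funext v w
  exact propext strandArc_flip

/-- The Cambrian tree of a placement of the labels at distinct heights. -/
def strandTree (ε : Fin n → ℤˣ) {pos : Fin n → ℤ} (hpos : Function.Injective pos) :
    CambrianTree ε where
  arc := strandArc ε pos
  asymm _ _ := strandArc.asymm
  connected := strandArc_preconnected hpos
  acyclic := strandArc_isAcyclic hpos
  parent_of_neg := strandArc_parent hpos
  children_of_neg := strandArc_children hpos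
  child_of_pos v hv := by
    have := strandArc_parent (ε := -ε) (neg_injective.comp hpos) v (by simp [hv])
    rwa [show (Neg.neg ∘ pos) = -pos from rfl, strandArc_flip_eq] at this
  parents_of_pos v hv := by
    have := strandArc_children (ε := -ε) (neg_injective.comp hpos) v (by simp [hv])
    rw [show (Neg.neg ∘ pos) = -pos from rfl, strandArc_flip_eq] at this
    exact this.flip

theorem strandArc.lt {i j : Fin n} (h : strandArc ε pos i j) : pos i < pos j := by
  obtain ⟨l, r, h⟩ := h
  exact h.lt

end Strands

/-! ### Paths in an arbitrary Cambrian tree: peaks, valleys and comparability. -/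

namespace CambrianTree

variable {n : ℕ} {ε : Fin n → ℤˣ}

theorem adj_iff (T : CambrianTree ε) {v w : Fin n} :
    (underlying T.arc).Adj v w ↔ T.arc v w ∨ T.arc w v :=
  underlying_adj T.asymm

/-- Two distinct children of a vertex `v` have their subtrees on opposite sides of `v`, and `v` is
negative. -/
theorem separated_of_children (T : CambrianTree ε) {v x z : Fin n} (hx : T.arc x v)
    (hz : T.arc z v) (hxz : x ≠ z) :
    ε v = -1 ∧ ((∀ u ∈ subtreeAt T.arc v x, ∀ u' ∈ subtreeAt T.arc v z, u < v ∧ v < u') ∨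
      (∀ u ∈ subtreeAt T.arc v x, ∀ u' ∈ subtreeAt T.arc v z, v < u ∧ u' < v)) := by
  have hv : ε v = -1 := by
    rcases sign_cases (ε v) with h | h
    · exact (hxz (T.child_of_pos v h.1 hx hz)).elim
    · exact h.1
  have hc := T.children_of_neg v hv
  have mem : ∀ {w}, T.arc w v → w ∈ subtreeAt T.arc v w := by
    intro w hw
    refine ⟨.nil, ?_⟩
    simp only [SimpleGraph.Walk.support_nil, List.mem_singleton]
    rintro rfl
    exact T.asymm _ _ hw hw
  refine ⟨hv, ?_⟩
  rcases hc.side x hx with h1 | h1 <;> rcases hc.side z hz with h2 | h2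
  · exact (hxz (hc.left x hx z hz (h1 _ (mem hx)) (h2 _ (mem hz)))).elim
  · exact .inl fun u hu u' hu' => ⟨h1 u hu, h2 u' hu'⟩
  · exact .inr fun u hu u' hu' => ⟨h1 u hu, h2 u' hu'⟩
  · exact (hxz (hc.right x hx z hz (h1 _ (mem hx)) (h2 _ (mem hz)))).elim

/-- Following a path that has climbed from `a` to `v` and continues to `c`, either it climbs up to
`c` or its first peak is negative and separates `a` from `c`, and from all vertices `d` further
away. -/
theorem climb (T : CambrianTree ε) {v c d a x : Fin n} (q : (underlying T.arc).Walk v c)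
    (hq : q.IsPath) (s : (underlying T.arc).Walk c d)
    (hs : ∀ y ∈ s.support, y ∈ q.support → y = c)
    (hxv : T.arc x v) (r : (underlying T.arc).Walk x a) (hr : ∀ y ∈ r.support, y ∉ q.support)
    (hav : Relation.TransGen T.arc a v) :
    Relation.TransGen T.arc a c ∨ ∃ y, ε y = -1 ∧ Relation.TransGen T.arc a y ∧
      ((a < y ∧ y < c ∧ y < d) ∨ (y < a ∧ c < y ∧ d < y)) := by
  induction q generalizing x with
  | nil => exact .inl hav
  | @cons v z c hadj q ih =>
    rw [SimpleGraph.Walk.cons_isPath_iff] at hq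
    rcases T.adj_iff.1 hadj with h | h
    · refine ih hq.1 s (fun y hy hy' => hs y hy (by simp [hy'])) h
        (.cons (T.adj_iff.2 (.inr hxv)) r) ?_ (hav.tail h)
      intro y hy hy'
      rw [SimpleGraph.Walk.support_cons, List.mem_cons] at hy
      rcases hy with rfl | hy
      · exact hq.2 hy'
      · exact hr y hy (by simp [hy'])
    -- The path turns down at `v`, so `x` and `z` are two children of `v`, and `v` is the first
    -- peak.
    · have hxz : x ≠ z := by
        rintro rfl
        exact hr x r.start_mem_support (by simp)
      obtain ⟨hv, hsep⟩ := T.separated_of_children hxv h hxz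
      have ha : a ∈ subtreeAt T.arc v x := ⟨r, fun h => hr v h (by simp)⟩
      have hc : c ∈ subtreeAt T.arc v z := ⟨q, hq.2⟩
      -- The continuation `s` avoids `v`, because it meets the path to `c` only in `c`; hence `d`
      -- lies in the same subtree as `c`.
      have hd : d ∈ subtreeAt T.arc v z := by
        refine ⟨q.append s, ?_⟩
        rw [SimpleGraph.Walk.mem_support_append_iff, not_or]
        refine ⟨hq.2, fun hvs => hq.2 ?_⟩
        have hvc := hs v hvs (by simp)
        exact hvc ▸ q.end_mem_support
      refine .inr ⟨v, hv, hav, ?_⟩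
      rcases hsep with hsep | hsep
      · exact .inl ⟨(hsep a ha c hc).1, (hsep a ha c hc).2, (hsep a ha d hd).2⟩
      · exact .inr ⟨(hsep a ha c hc).1, (hsep a ha c hc).2, (hsep a ha d hd).2⟩

theorem climb_of_arc (T : CambrianTree ε) {a z c d : Fin n} (haz : T.arc a z)
    (q : (underlying T.arc).Walk z c) (hq : q.IsPath) (haq : a ∉ q.support)
    (s : (underlying T.arc).Walk c d) (hs : ∀ y ∈ s.support, y ∈ q.support → y = c) :
    Relation.TransGen T.arc a c ∨ ∃ y, ε y = -1 ∧ Relation.TransGen T.arc a y ∧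
      ((a < y ∧ y < c ∧ y < d) ∨ (y < a ∧ c < y ∧ d < y)) :=
  T.climb q hq s hs haz .nil (by simpa using haq) (.single haz)

theorem transGen_reverse (T : CambrianTree ε) {a b : Fin n} :
    Relation.TransGen T.reverse.arc a b ↔ Relation.TransGen T.arc b a :=
  Relation.transGen_swap

theorem underlying_reverse (T : CambrianTree ε) : underlying T.reverse.arc = underlying T.arc :=
  underlying_flip T.arc

/-- Two vertices are comparable, or separated by a negative vertex above the first one or by a
positive vertex below it. -/
theorem comparable_or_separated (T : CambrianTree ε) {a c : Fin n} (hac : a ≠ c) :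
    Relation.TransGen T.arc a c ∨ Relation.TransGen T.arc c a ∨
      ∃ y, ((ε y = -1 ∧ Relation.TransGen T.arc a y) ∨ (ε y = 1 ∧ Relation.TransGen T.arc y a)) ∧
        ((a < y ∧ y < c) ∨ (c < y ∧ y < a)) := by
  obtain ⟨p, hp⟩ := (T.connected a c).exists_isPath
  cases p with
  | nil => exact (hac rfl).elim
  | @cons _ z _ hadj q =>
    rw [SimpleGraph.Walk.cons_isPath_iff] at hp
    -- A path that leaves `a` upwards is treated by `climb_of_arc`, one that leaves downwards by the
    -- same statement for the reversed tree.
    rcases T.adj_iff.1 hadj with h | h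
    · rcases T.climb_of_arc h q hp.1 hp.2 .nil (by simp) with h | ⟨y, h1, h2, h3⟩
      · exact .inl h
      · exact .inr (.inr ⟨y, .inl ⟨h1, h2⟩, by tauto⟩)
    · have hG := T.underlying_reverse
      rcases T.reverse.climb_of_arc (a := a) (z := z) (c := c) (d := c) h
        (q.mapLe hG.ge) (by simpa using hp.1) (by simpa using hp.2) .nil (by simp) with
        h | ⟨y, h1, h2, h3⟩
      · exact .inr (.inl (T.transGen_reverse.1 h))
      · exact .inr (.inr ⟨y, .inr ⟨by simpa using h1, T.transGen_reverse.1 h2⟩, by tauto⟩)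

/-- A negative vertex between two adjacent vertices lies below one of them. -/
theorem below_of_adj_of_neg (T : CambrianTree ε) {a b c : Fin n}
    (hac : (underlying T.arc).Adj a c) (hab : a < b) (hbc : b < c) (hb : ε b = -1) :
    Relation.TransGen T.arc b a ∨ Relation.TransGen T.arc b c := by
  have key : ∀ {a c : Fin n}, (underlying T.arc).Adj a c →
      ((a < b ∧ b < c) ∨ (c < b ∧ b < a)) →
      ∀ p : (underlying T.arc).Walk b a, p.IsPath → c ∉ p.support → Relation.TransGen T.arc b a := by
    intro a c hac hbet p hp hc
    cases p with
    | nil => omega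
    | @cons _ z _ hadj q =>
      rw [SimpleGraph.Walk.cons_isPath_iff] at hp
      rw [SimpleGraph.Walk.support_cons, List.mem_cons, not_or] at hc
      have haz : a ∈ subtreeAt T.arc b z := ⟨q, hp.2⟩
      have hcz : c ∈ subtreeAt T.arc b z := by
        refine ⟨q.append (.cons hac .nil), ?_⟩
        rw [SimpleGraph.Walk.mem_support_append_iff]
        simp only [SimpleGraph.Walk.support_cons, SimpleGraph.Walk.support_nil, List.mem_cons,
          List.not_mem_nil, or_false, not_or]
        exact ⟨hp.2, fun h => hp.2 (h ▸ q.end_mem_support), fun h => hc.1 h.symm⟩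
      rcases T.adj_iff.1 hadj with h | h
      -- A peak would put `a` and `c` on the same side of `b`, although `b` lies between them; so
      -- the path climbs all the way to `a`.
      · rcases T.climb_of_arc h q hp.1 hp.2 (.cons hac .nil) (by
          intro y hy hyq
          simp only [SimpleGraph.Walk.support_cons, SimpleGraph.Walk.support_nil, List.mem_cons,
            List.not_mem_nil, or_false] at hy
          rcases hy with rfl | rfl
          · rfl
          · exact (hc.2 hyq).elim) with h | ⟨y, -, -, h⟩
        · exact h
        · omega
      · rcases (T.children_of_neg b hb).side z h with h | h
        · have := h a haz; have := h c hcz; omega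
        · have := h a haz; have := h c hcz; omega
  obtain ⟨p, hp⟩ := (T.connected b a).exists_isPath
  -- If the path to `a` passes through `c`, it is cut at `c`, and `a` and `c` exchange roles.
  by_cases hc : c ∈ p.support
  · right
    refine key hac.symm (.inr ⟨hab, hbc⟩) (p.takeUntil c hc) (hp.takeUntil hc) ?_
    exact SimpleGraph.Walk.endpoint_notMem_support_takeUntil hp hc hac.ne
  · exact .inl (key hac (.inl ⟨hab, hbc⟩) p hp hc)

theorem above_of_adj_of_pos (T : CambrianTree ε) {a b c : Fin n}
    (hac : (underlying T.arc).Adj a c) (hab : a < b) (hbc : b < c) (hb : ε b = 1) :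
    Relation.TransGen T.arc a b ∨ Relation.TransGen T.arc c b := by
  have := T.reverse.below_of_adj_of_neg (a := a) (b := b) (c := c)
    (by rwa [T.underlying_reverse]) hab hbc (by simp [hb])
  rwa [T.transGen_reverse, T.transGen_reverse] at this

end CambrianTree

/-! ### The Cambrian and Baxter congruences on words and their compatibilities. -/

section WordCongruence

/-- The Cambrian congruence on words. -/
def WordCongr : List Letter → List Letter → Prop := Relation.EqvGen CambrianStep

/-- The word obtained by changing all signs. -/
def negWord (w : List Letter) : List Letter := w.map fun x => (x.1, -x.2)

/-- The words congruent for the Cambrian congruence, both before and after changing all signs. -/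
def BaxterCongr (u v : List Letter) : Prop := WordCongr u v ∧ WordCongr (negWord u) (negWord v)

theorem CambrianStep.perm {u v : List Letter} (h : CambrianStep u v) : u.Perm v := by
  cases h with
  | neg U V W a b c => exact (List.Perm.swap c a _).append_left U
  | pos U V W a b c => exact (((List.Perm.swap c a _).append_left V).cons b).append_left U

theorem WordCongr.refl (u : List Letter) : WordCongr u u := Relation.EqvGen.refl u

theorem WordCongr.symm {u v : List Letter} (h : WordCongr u v) : WordCongr v u :=
  Relation.EqvGen.symm _ _ h

theorem WordCongr.trans {u v w : List Letter} (h : WordCongr u v) (h' : WordCongr v w) :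
    WordCongr u w :=
  Relation.EqvGen.trans _ _ _ h h'

theorem WordCongr.perm {u v : List Letter} (h : WordCongr u v) : u.Perm v := by
  induction h with
  | rel u v h => exact h.perm
  | refl u => exact .refl u
  | symm u v _ ih => exact ih.symm
  | trans u v w _ _ ih ih' => exact ih.trans ih'

theorem CambrianStep.append_left {u v : List Letter} (h : CambrianStep u v) (w : List Letter) :
    CambrianStep (w ++ u) (w ++ v) := by
  cases h with
  | neg U V W a b c hab hbc hb => simpa using CambrianStep.neg (w ++ U) V W a b c hab hbc hb
  | pos U V W a b c hab hbc hb => simpa using CambrianStep.pos (w ++ U) V W a b c hab hbc hb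

theorem CambrianStep.append_right {u v : List Letter} (h : CambrianStep u v) (w : List Letter) :
    CambrianStep (u ++ w) (v ++ w) := by
  cases h with
  | neg U V W a b c hab hbc hb => simpa using CambrianStep.neg U V (W ++ w) a b c hab hbc hb
  | pos U V W a b c hab hbc hb => simpa using CambrianStep.pos U V (W ++ w) a b c hab hbc hb

theorem CambrianStep.map {u v : List Letter} (h : CambrianStep u v) {f : ℕ → ℕ}
    (hf : StrictMonoOn f {a | a ∈ values u}) :
    CambrianStep (u.map fun x => (f x.1, x.2)) (v.map fun x => (f x.1, x.2)) := by
  cases h with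
  | neg U V W a b c hab hbc hb =>
    simp only [List.map_append, List.map_cons]
    exact .neg _ _ _ (f a.1, a.2) (f b.1, b.2) (f c.1, c.2) (hf (by simp [values])
      (by simp [values]) hab) (hf (by simp [values]) (by simp [values]) hbc) hb
  | pos U V W a b c hab hbc hb =>
    simp only [List.map_append, List.map_cons]
    exact .pos _ _ _ (f a.1, a.2) (f b.1, b.2) (f c.1, c.2) (hf (by simp [values])
      (by simp [values]) hab) (hf (by simp [values]) (by simp [values]) hbc) hb

/-- If both exchanged letters survive, so does the witness, whose value lies between theirs. If at
most one survives, the two restrictions are equal. -/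
theorem CambrianStep.filter {u v : List Letter} (h : CambrianStep u v) {I : Set ℕ}
    [DecidablePred (· ∈ I)] (hI : I.OrdConnected) :
    WordCongr (u.filter fun x => x.1 ∈ I) (v.filter fun x => x.1 ∈ I) := by
  cases h with
  | neg U V W a b c hab hbc hb =>
    by_cases ha : a.1 ∈ I
    · by_cases hc : c.1 ∈ I
      · have hbI : b.1 ∈ I := hI.out ha hc ⟨hab.le, hbc.le⟩
        simp only [List.filter_append, List.filter_cons, ha, hc, hbI, decide_true, if_true]
        exact .rel _ _ (.neg _ _ _ a b c hab hbc hb)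
      · simp only [List.filter_append, List.filter_cons, ha, hc, decide_true, decide_false]
        exact .refl _
    · simp only [List.filter_append, List.filter_cons, ha, decide_false]
      exact .refl _
  | pos U V W a b c hab hbc hb =>
    by_cases ha : a.1 ∈ I
    · by_cases hc : c.1 ∈ I
      · have hbI : b.1 ∈ I := hI.out ha hc ⟨hab.le, hbc.le⟩
        simp only [List.filter_append, List.filter_cons, ha, hc, hbI, decide_true, if_true]
        exact .rel _ _ (.pos _ _ _ a b c hab hbc hb)
      · simp only [List.filter_append, List.filter_cons, ha, hc, decide_true, decide_false]
        exact .refl _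
    · simp only [List.filter_append, List.filter_cons, ha, decide_false]
      exact .refl _

theorem WordCongr.lift {g : List Letter → List Letter}
    (hg : ∀ u v, CambrianStep u v → WordCongr (g u) (g v)) {u v : List Letter}
    (h : WordCongr u v) : WordCongr (g u) (g v) := by
  induction h with
  | rel u v h => exact hg u v h
  | refl u => exact .refl _
  | symm u v _ ih => exact ih.symm
  | trans u v w _ _ ih ih' => exact ih.trans ih'

theorem WordCongr.append {u v u' v' : List Letter} (h : WordCongr u v) (h' : WordCongr u' v') :
    WordCongr (u ++ u') (v ++ v') :=
  (h.lift (g := (· ++ u')) fun _ _ h => .rel _ _ (h.append_right u')).trans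
    (h'.lift (g := (v ++ ·)) fun _ _ h => .rel _ _ (h.append_left v))

theorem WordCongr.filter {u v : List Letter} (h : WordCongr u v) {I : Set ℕ}
    [DecidablePred (· ∈ I)] (hI : I.OrdConnected) :
    WordCongr (u.filter fun x => x.1 ∈ I) (v.filter fun x => x.1 ∈ I) :=
  h.lift fun _ _ h => h.filter hI

theorem values_perm {u v : List Letter} (h : u.Perm v) : (values u).Perm (values v) := h.map _

theorem WordCongr.map {u v : List Letter} (h : WordCongr u v) {f : ℕ → ℕ}
    (hf : StrictMonoOn f {a | a ∈ values u}) :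
    WordCongr (u.map fun x => (f x.1, x.2)) (v.map fun x => (f x.1, x.2)) := by
  induction h with
  | rel u v h => exact .rel _ _ (h.map hf)
  | refl u => exact .refl _
  | symm u v h ih =>
    refine (ih (hf.mono fun a ha => ?_)).symm
    exact (values_perm (WordCongr.perm h)).subset ha
  | trans u v w h h' ih ih' =>
    refine (ih hf).trans (ih' (hf.mono fun a ha => ?_))
    exact (values_perm (WordCongr.perm h)).symm.subset ha

theorem values_negWord (w : List Letter) : values (negWord w) = values w := by
  simp [values, negWord, Function.comp_def]

theorem negWord_append (u v : List Letter) : negWord (u ++ v) = negWord u ++ negWord v := by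
  simp [negWord]

theorem negWord_map (f : ℕ → ℕ) (w : List Letter) : negWord (w.map fun x => (f x.1, x.2)) =
    (negWord w).map fun x => (f x.1, x.2) := by
  simp [negWord, Function.comp_def]

theorem negWord_filter (p : ℕ → Bool) (w : List Letter) : negWord (w.filter fun x => p x.1) =
    (negWord w).filter fun x => p x.1 := by
  simp [negWord, List.filter_map, Function.comp_def]

namespace BaxterCongr

theorem refl (u : List Letter) : BaxterCongr u u := ⟨.refl _, .refl _⟩

theorem symm {u v : List Letter} (h : BaxterCongr u v) : BaxterCongr v u := ⟨h.1.symm, h.2.symm⟩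

theorem trans {u v w : List Letter} (h : BaxterCongr u v) (h' : BaxterCongr v w) :
    BaxterCongr u w :=
  ⟨h.1.trans h'.1, h.2.trans h'.2⟩

theorem perm {u v : List Letter} (h : BaxterCongr u v) : u.Perm v := h.1.perm

theorem append {u v u' v' : List Letter} (h : BaxterCongr u v) (h' : BaxterCongr u' v') :
    BaxterCongr (u ++ u') (v ++ v') := by
  refine ⟨h.1.append h'.1, ?_⟩
  rw [negWord_append, negWord_append]
  exact h.2.append h'.2

theorem filter {u v : List Letter} (h : BaxterCongr u v) {I : Set ℕ}
    [DecidablePred (· ∈ I)] (hI : I.OrdConnected) :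
    BaxterCongr (u.filter fun x => x.1 ∈ I) (v.filter fun x => x.1 ∈ I) := by
  refine ⟨h.1.filter hI, ?_⟩
  rw [negWord_filter fun a => decide (a ∈ I), negWord_filter fun a => decide (a ∈ I)]
  exact h.2.filter hI

theorem map {u v : List Letter} (h : BaxterCongr u v) {f : ℕ → ℕ}
    (hf : StrictMonoOn f {a | a ∈ values u}) :
    BaxterCongr (u.map fun x => (f x.1, x.2)) (v.map fun x => (f x.1, x.2)) := by
  refine ⟨h.1.map hf, ?_⟩
  rw [negWord_map, negWord_map]
  exact h.2.map (by rwa [values_negWord])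

end BaxterCongr

/-- All intermediate words of a chain of rewritings are rearrangements of the first, so they are
again signed permutations. -/
theorem cambrianCongr_iff {σ τ : SignedPerm} :
    CambrianCongr σ τ ↔ WordCongr σ.word τ.word := by
  constructor
  · intro h
    induction h with
    | rel σ τ h => exact .rel _ _ h
    | refl σ => exact .refl _
    | symm σ τ _ ih => exact ih.symm
    | trans σ τ ρ _ _ ih ih' => exact ih.trans ih'
  · have key : ∀ u v, WordCongr u v → ∀ σ τ : SignedPerm, σ.word = u → τ.word = v →
        CambrianCongr σ τ := by
      intro u v h
      induction h with
      | rel u v h =>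
        rintro σ τ rfl rfl
        exact .rel _ _ h
      | refl u =>
        intro σ τ h h'
        rw [SignedPerm.ext (h.trans h'.symm)]
        exact .refl _
      | symm u v _ ih => exact fun σ τ h h' => .symm _ _ (ih τ σ h' h)
      | trans u v w h _ ih ih' =>
        rintro σ τ rfl rfl
        have hp := WordCongr.perm h
        let ρ : SignedPerm := ⟨v, ((values_perm hp).symm.trans σ.perm).trans
          (by rw [hp.length_eq])⟩
        exact .trans _ ρ _ (ih σ ρ rfl rfl) (ih' ρ τ rfl rfl)
    exact fun h => key _ _ h σ τ rfl rfl

end WordCongruence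

open scoped TensorProduct

/-! ### Linear combinations constant on equivalence classes. -/

section ClassSums

/-- A linear combination with coefficients constant on the classes of an equivalence relation is a
linear combination of class sums. -/
theorem sum_smul_mem_span_classSums {k A M : Type*} [DecidableEq A] [CommRing k] [AddCommGroup M]
    [Module k M] (cls : A → Finset A) (hself : ∀ a, a ∈ cls a)
    (heq : ∀ a, ∀ b ∈ cls a, cls b = cls a) (c : A → k) (hc : ∀ a, ∀ b ∈ cls a, c b = c a)
    (f : A → M) (S : Finset A) (hS : ∀ a ∈ S, cls a ⊆ S) :
    ∑ a ∈ S, c a • f a ∈ Submodule.span k ((fun a => ∑ b ∈ cls a, f b) '' (S : Set A)) := by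
  induction S using Finset.strongInduction with
  | H S ih =>
    rcases S.eq_empty_or_nonempty with rfl | ⟨a, ha⟩
    · simp
    · have hsub := hS a ha
      -- One whole class is split off; the rest is still a union of classes.
      rw [← Finset.sum_sdiff hsub]
      refine Submodule.add_mem _ ?_ ?_
      · refine Submodule.span_mono (Set.image_mono ?_) (ih (S \ cls a) ?_ ?_)
        · exact_mod_cast Finset.sdiff_subset
        · exact Finset.sdiff_ssubset hsub ⟨a, hself a⟩
        · intro b hb d hd
          rw [Finset.mem_sdiff] at hb ⊢
          refine ⟨hS b hb.1 hd, fun hda => hb.2 ?_⟩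
          rw [← heq a d hda, heq b d hd]
          exact hself b
      · rw [Finset.sum_congr rfl fun b hb => by rw [hc a b hb], ← Finset.smul_sum]
        exact Submodule.smul_mem _ _ (Submodule.subset_span ⟨a, ha, rfl⟩)

end ClassSums

/-! ### Baxter-Cambrian classes as finite sets. -/

namespace SignedPerm

/-- A rearrangement of the word of a signed permutation, as a signed permutation. -/
def ofPerm (σ : SignedPerm) (w : List Letter) (h : w.Perm σ.word) : SignedPerm :=
  ⟨w, ((values_perm h).trans σ.perm).trans (by rw [h.length_eq])⟩

theorem finite_baxterCongr (σ : SignedPerm) :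
    {τ : SignedPerm | BaxterCongr τ.word σ.word}.Finite := by
  refine ((List.finite_toSet σ.word.permutations).preimage (f := SignedPerm.word)
    fun _ _ _ _ h => SignedPerm.ext h).subset fun τ h => ?_
  exact List.mem_permutations.2 (BaxterCongr.perm h)

/-- The Baxter-Cambrian class of a signed permutation. -/
noncomputable def baxterClass (σ : SignedPerm) : Finset SignedPerm :=
  σ.finite_baxterCongr.toFinset

theorem mem_baxterClass {σ τ : SignedPerm} : τ ∈ σ.baxterClass ↔ BaxterCongr τ.word σ.word := by
  simp [baxterClass]

theorem self_mem_baxterClass (σ : SignedPerm) : σ ∈ σ.baxterClass :=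
  mem_baxterClass.2 (.refl _)

theorem baxterClass_eq (σ τ : SignedPerm) (h : τ ∈ σ.baxterClass) :
    τ.baxterClass = σ.baxterClass := by
  rw [mem_baxterClass] at h
  ext ρ
  rw [mem_baxterClass, mem_baxterClass]
  exact ⟨fun h' => h'.trans h, fun h' => h'.trans h.symm⟩

theorem size_of_mem_baxterClass {σ τ : SignedPerm} (h : τ ∈ σ.baxterClass) :
    τ.size = σ.size :=
  (mem_baxterClass.1 h).perm.length_eq

end SignedPerm

/-! ### Shuffles and restriction to intervals of values. -/

section Shuffles

/-- For shifted shuffles, `p` will be the comparison of values with the shift. Both factors can then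
be read off from any shuffle. -/
theorem filter_of_mem_shuffle {α : Type*} (p : α → Bool) (u v w : List α) (hw : w ∈ shuffle u v)
    (hu : ∀ x ∈ u, p x = true) (hv : ∀ x ∈ v, p x = false) :
    w.filter p = u ∧ w.filter (fun x => !p x) = v := by
  induction u generalizing v w with
  | nil =>
    simp only [shuffle_nil_left, Multiset.mem_singleton] at hw
    subst hw
    simpa [List.filter_eq_nil_iff, List.filter_eq_self] using hv
  | cons a u ih =>
    induction v generalizing w with
    | nil =>
      simp only [shuffle_nil_right, Multiset.mem_singleton] at hw
      subst hw
      simpa [List.filter_eq_nil_iff, List.filter_eq_self] using hu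
    | cons b v ih' =>
      simp only [shuffle_cons, Multiset.mem_add, Multiset.mem_map] at hw
      rcases hw with ⟨x, hx, rfl⟩ | ⟨x, hx, rfl⟩
      · have h1 := ih _ _ hx (fun y hy => hu y (by simp [hy])) hv
        simp [hu a (by simp), h1.1, h1.2]
      · have h1 := ih' _ hx fun y hy => hv y (by simp [hy])
        simp [hv b (by simp), h1.1, h1.2]

theorem cons_mem_shuffle_left {α : Type*} (a : α) {u v w : List α} (h : w ∈ shuffle u v) :
    a :: w ∈ shuffle (a :: u) v := by
  cases v with
  | nil =>
    rw [shuffle_nil_right, Multiset.mem_singleton] at h ⊢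
    rw [h]
  | cons b v =>
    rw [shuffle_cons, Multiset.mem_add]
    exact .inl (Multiset.mem_map_of_mem _ h)

theorem cons_mem_shuffle_right {α : Type*} (b : α) {u v w : List α} (h : w ∈ shuffle u v) :
    b :: w ∈ shuffle u (b :: v) := by
  cases u with
  | nil =>
    rw [shuffle_nil_left, Multiset.mem_singleton] at h ⊢
    rw [h]
  | cons a u =>
    rw [shuffle_cons, Multiset.mem_add]
    exact .inr (Multiset.mem_map_of_mem _ h)

theorem mem_shuffle_filter {α : Type*} (p : α → Bool) (w : List α) :
    w ∈ shuffle (w.filter p) (w.filter fun x => !p x) := by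
  induction w with
  | nil => simp [shuffle_nil_left]
  | cons a w ih =>
    cases h : p a
    · simpa [h] using cons_mem_shuffle_right a ih
    · simpa [h] using cons_mem_shuffle_left a ih

theorem SignedPerm.mem_shiftedShuffle {σ τ ρ : SignedPerm} :
    ρ ∈ σ.shiftedShuffle τ ↔ ρ.word ∈ shuffle σ.word (shiftWord σ.size τ.word) := by
  unfold shiftedShuffle
  rw [Finset.mem_mk, Multiset.mem_pmap]
  constructor
  · rintro ⟨w, hw, rfl⟩
    exact hw
  · exact fun h => ⟨ρ.word, h, rfl⟩

theorem shiftWord_injective (m : ℕ) : Function.Injective (shiftWord m) := by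
  refine List.map_injective_iff.2 fun x y h => ?_
  simp only [Prod.mk.injEq, Nat.add_right_cancel_iff] at h
  exact Prod.ext h.1 h.2

theorem not_decide_mem_Iio (m x : ℕ) : (!decide (x ∈ Set.Iio m)) = decide (x ∈ Set.Ici m) := by
  rw [← decide_not]
  exact decide_eq_decide.2 (not_lt (a := x) (b := m))

theorem SignedPerm.filter_of_mem_shiftedShuffle {σ τ ρ : SignedPerm}
    (h : ρ ∈ σ.shiftedShuffle τ) :
    ρ.word.filter (fun x => x.1 ∈ Set.Iio σ.size) = σ.word ∧
      ρ.word.filter (fun x => x.1 ∈ Set.Ici σ.size) = shiftWord σ.size τ.word := by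
  have := filter_of_mem_shuffle (fun x => decide (x.1 ∈ Set.Iio σ.size)) _ _ _
    (mem_shiftedShuffle.1 h) (fun x hx => by
      simpa using σ.lt_size (List.mem_map_of_mem hx)) (fun x hx => by
      obtain ⟨y, -, rfl⟩ := List.mem_map.1 hx
      simp)
  refine ⟨this.1, this.2 ▸ List.filter_congr fun x _ => ?_⟩
  exact (not_decide_mem_Iio _ _).symm

open Classical in
/-- The union of the shifted shuffles of two Baxter-Cambrian classes is a union of classes. -/
theorem SignedPerm.baxterClass_subset_biUnion (σ τ ρ : SignedPerm)
    (h : ρ ∈ (σ.baxterClass ×ˢ τ.baxterClass).biUnion fun p => p.1.shiftedShuffle p.2) :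
    ρ.baxterClass ⊆ (σ.baxterClass ×ˢ τ.baxterClass).biUnion fun p => p.1.shiftedShuffle p.2 := by
  intro ρ' hρ'
  rw [Finset.mem_biUnion] at h ⊢
  obtain ⟨⟨σ₁, τ₁⟩, h1, h2⟩ := h
  rw [Finset.mem_product] at h1
  simp only at h1 h2
  obtain ⟨h3, h4⟩ := filter_of_mem_shiftedShuffle h2
  rw [mem_baxterClass] at hρ'
  -- The small and the large values form intervals, so both restrictions of `ρ'` are congruent to
  -- those of `ρ`, and `ρ'` is a shuffle of its own restrictions.
  have h5 := hρ'.filter (I := Set.Iio σ₁.size) Set.ordConnected_Iio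
  have h6 := hρ'.filter (I := Set.Ici σ₁.size) Set.ordConnected_Ici
  rw [h3] at h5
  rw [h4] at h6
  have h7 := h6.map (f := fun a => a - σ₁.size) (by
    intro a ha b hb hab
    simp only [values, List.mem_map, List.mem_filter, Set.mem_ofPred_eq, decide_eq_true_eq,
      Set.mem_Ici] at ha hb
    obtain ⟨x, hx, rfl⟩ := ha
    obtain ⟨y, hy, rfl⟩ := hb
    dsimp only
    omega)
  have h8 : (shiftWord σ₁.size τ₁.word).map (fun x => (x.1 - σ₁.size, x.2)) = τ₁.word := by
    simp [shiftWord, Function.comp_def]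
  rw [h8] at h7
  refine ⟨(σ₁.ofPerm _ h5.perm, τ₁.ofPerm _ h7.perm), Finset.mem_product.2 ⟨?_, ?_⟩, ?_⟩
  · exact mem_baxterClass.2 (h5.trans (mem_baxterClass.1 h1.1))
  · exact mem_baxterClass.2 (h7.trans (mem_baxterClass.1 h1.2))
  · rw [mem_shiftedShuffle]
    have hs : (σ₁.ofPerm _ h5.perm).size = σ₁.size := h5.perm.length_eq
    rw [hs]
    have h9 := mem_shuffle_filter (fun x : Letter => decide (x.1 ∈ Set.Iio σ₁.size)) ρ'.word
    simp only [not_decide_mem_Iio] at h9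
    change _ ∈ shuffle (ρ'.word.filter fun x => decide (x.1 ∈ Set.Iio σ₁.size))
      (shiftWord σ₁.size ((ρ'.word.filter fun x => decide (x.1 ∈ Set.Ici σ₁.size)).map fun x =>
        (x.1 - σ₁.size, x.2)))
    convert h9 using 2
    rw [shiftWord, List.map_map]
    conv_rhs => rw [← List.map_id (List.filter _ _)]
    refine List.map_congr_left fun x hx => ?_
    have : σ₁.size ≤ x.1 := by simpa using (List.mem_filter.1 hx).2
    exact Prod.ext (Nat.sub_add_cancel this) rfl

end Shuffles

/-! ### Undoing standardization, and counting the cuts of a class. -/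

section Relabelling

/-- The order preserving enumeration of a set of natural numbers, continued by the natural numbers
larger than all its elements. -/
noncomputable def enumeration (s : Set ℕ) : ℕ → ℕ :=
  Nat.nth fun a => a ∈ s ∨ ∀ b ∈ s, b < a

/-- The larger numbers added to `s` make the enumerated set infinite. Without them `Nat.nth` would
take its default value `0` after the last element. -/
theorem enumeration_strictMono (s : Set ℕ) (hs : s.Finite) : StrictMono (enumeration s) := by
  refine Nat.nth_strictMono ?_
  obtain ⟨m, hm⟩ := hs.bddAbove
  refine (Set.Ioi_infinite m).mono fun a ha => .inr fun b hb => ?_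
  exact (hm hb).trans_lt ha

/-- Below an element of `l` the added numbers play no role, so its rank in `l` is its index in the
enumeration. -/
theorem enumeration_countP (l : List ℕ) (hl : l.Nodup) {x : ℕ} (hx : x ∈ l) :
    enumeration {a | a ∈ l} (l.countP fun a => decide (a < x)) = x := by
  classical
  have h : l.countP (fun a => decide (a < x)) =
      Nat.count (fun a => a ∈ {a | a ∈ l} ∨ ∀ b ∈ {a | a ∈ l}, b < a) x := by
    rw [Nat.count_eq_card_filter_range, List.countP_eq_length_filter,
      ← List.toFinset_card_of_nodup (hl.filter _)]
    congr 1
    ext a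
    simp only [List.mem_toFinset, List.mem_filter, decide_eq_true_eq, Finset.mem_filter,
      Finset.mem_range, Set.mem_ofPred_eq]
    constructor
    · exact fun h => ⟨h.2, .inl h.1⟩
    · rintro ⟨h1, h2 | h2⟩
      · exact ⟨h2, h1⟩
      · exact absurd (h2 x hx) (by omega)
  rw [h]
  exact Nat.nth_count (.inl hx)

theorem stdWord_map_enumeration (w : List Letter) (hw : (values w).Nodup) :
    (stdWord w).map (fun x => (enumeration {a | a ∈ values w} x.1, x.2)) = w := by
  conv_rhs => rw [← List.map_id w]
  rw [stdWord, List.map_map]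
  refine List.map_congr_left fun x hx => ?_
  exact Prod.ext (enumeration_countP _ hw (List.mem_map_of_mem hx)) rfl

open Classical in
/-- The signed permutations of a class whose prefix of length `i` and complementary suffix have
given standardizations are at most as many as those for congruent standardizations. -/
theorem SignedPerm.card_cut_le (σ₀ : SignedPerm) (i : ℕ) (hi : i ≤ σ₀.size)
    {α β α' β' : SignedPerm} (hα : BaxterCongr α'.word α.word) (hβ : BaxterCongr β'.word β.word) :
    (σ₀.baxterClass.filter fun σ => (σ.take i, σ.drop i) = (α, β)).card ≤
      (σ₀.baxterClass.filter fun σ => (σ.take i, σ.drop i) = (α', β')).card := by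
  let e : List Letter → ℕ → ℕ := fun w => enumeration {a | a ∈ values w}
  have he : ∀ w, StrictMono (e w) := fun w => enumeration_strictMono _ (List.finite_toSet _)
  -- The patterns of the prefix and of the suffix are replaced by `α'` and `β'`, while each part
  -- keeps its set of values.
  let g : SignedPerm → List Letter := fun σ =>
    (α'.word.map fun x => (e (σ.word.take i) x.1, x.2)) ++
      (β'.word.map fun x => (e (σ.word.drop i) x.1, x.2))
  have hw : ∀ σ : SignedPerm, (σ.take i, σ.drop i) = (α, β) →
      (α.word.map fun x => (e (σ.word.take i) x.1, x.2)) = σ.word.take i ∧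
      (β.word.map fun x => (e (σ.word.drop i) x.1, x.2)) = σ.word.drop i := by
    rintro σ h
    obtain ⟨rfl, rfl⟩ := Prod.ext_iff.1 h
    exact ⟨stdWord_map_enumeration _ (σ.nodup.sublist ((List.take_sublist i σ.word).map _)),
      stdWord_map_enumeration _ (σ.nodup.sublist ((List.drop_sublist i σ.word).map _))⟩
  have hg1 : ∀ σ : SignedPerm, (σ.take i, σ.drop i) = (α, β) →
      BaxterCongr (α'.word.map fun x => (e (σ.word.take i) x.1, x.2)) (σ.word.take i) := by
    intro σ h
    have := hα.map ((he (σ.word.take i)).strictMonoOn _)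
    rwa [(hw σ h).1] at this
  have hg2 : ∀ σ : SignedPerm, (σ.take i, σ.drop i) = (α, β) →
      BaxterCongr (β'.word.map fun x => (e (σ.word.drop i) x.1, x.2)) (σ.word.drop i) := by
    intro σ h
    have := hβ.map ((he (σ.word.drop i)).strictMonoOn _)
    rwa [(hw σ h).2] at this
  have hg : ∀ σ : SignedPerm, (σ.take i, σ.drop i) = (α, β) → BaxterCongr (g σ) σ.word := by
    intro σ h
    have := (hg1 σ h).append (hg2 σ h)
    rwa [List.take_append_drop] at this
  have hlen : ∀ σ ∈ σ₀.baxterClass, (σ.take i, σ.drop i) = (α, β) →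
      (α'.word.map fun x => (e (σ.word.take i) x.1, x.2)).length = i := by
    intro σ hσ h
    have h1 := (hg1 σ h).perm.length_eq
    have h2 : σ.word.length = σ₀.size := size_of_mem_baxterClass hσ
    rw [h1, List.length_take]
    omega
  have hstd : ∀ (ρ : SignedPerm) (w : List Letter),
      stdWord (ρ.word.map fun x => (e w x.1, x.2)) = ρ.word := by
    intro ρ w
    rw [stdWord_map_of_strictMonoOn _ _ ((he w).strictMonoOn _), ρ.stdWord_word]
  have hex : ∀ σ : SignedPerm, ∃ ρ : SignedPerm, (σ.take i, σ.drop i) = (α, β) →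
      ρ.word = g σ := by
    intro σ
    by_cases h : (σ.take i, σ.drop i) = (α, β)
    · exact ⟨σ.ofPerm _ (hg σ h).perm, fun _ => rfl⟩
    · exact ⟨σ, fun h' => (h h').elim⟩
  choose G hG using hex
  refine Finset.card_le_card_of_injOn G ?_ ?_
  · intro σ hσ
    simp only [Finset.coe_filter, Set.mem_ofPred_eq] at hσ ⊢
    obtain ⟨h1, h2⟩ := hσ
    refine ⟨?_, ?_⟩
    · rw [mem_baxterClass, hG σ h2]
      exact (hg σ h2).trans (mem_baxterClass.1 h1)
    · refine Prod.ext (SignedPerm.ext ?_) (SignedPerm.ext ?_)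
      · change stdWord ((G σ).word.take i) = α'.word
        rw [hG σ h2, List.take_left' (hlen σ h1 h2), hstd]
      · change stdWord ((G σ).word.drop i) = β'.word
        rw [hG σ h2, List.drop_left' (hlen σ h1 h2), hstd]
  · intro σ hσ ρ hρ heq
    simp only [Finset.coe_filter, Set.mem_ofPred_eq] at hσ hρ
    have h1 := congrArg SignedPerm.word heq
    rw [hG σ hσ.2, hG ρ hρ.2] at h1
    obtain ⟨h2, h3⟩ := List.append_inj h1 ((hlen σ hσ.1 hσ.2).trans (hlen ρ hρ.1 hρ.2).symm)
    -- The image still shows which values occur in each part; with `α` and `β` given, these sets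
    -- determine the original word.
    have h4 : e (σ.word.take i) = e (ρ.word.take i) := by
      have hp := values_perm ((hg1 σ hσ.2).symm.trans (h2 ▸ hg1 ρ hρ.2)).perm
      exact congrArg enumeration (Set.ext fun a => hp.mem_iff)
    have h5 : e (σ.word.drop i) = e (ρ.word.drop i) := by
      have hp := values_perm ((hg2 σ hσ.2).symm.trans (h3 ▸ hg2 ρ hρ.2)).perm
      exact congrArg enumeration (Set.ext fun a => hp.mem_iff)
    refine SignedPerm.ext ?_
    rw [← List.take_append_drop i σ.word, ← (hw σ hσ.2).1, ← (hw σ hσ.2).2, h4, h5,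
      (hw ρ hρ.2).1, (hw ρ hρ.2).2, List.take_append_drop]

end Relabelling

/-! ### The span of the class sums is a Hopf subalgebra. -/

section HopfAlgebra

open FQSym

variable {k : Type*} [CommRing k]

variable (k) in
/-- The sum of the basis elements of a Baxter-Cambrian class. -/
noncomputable def classSum (σ : SignedPerm) : FQSym k := ∑ τ ∈ σ.baxterClass, F k τ

variable (k) in
/-- The span of the sums of the Baxter-Cambrian classes. -/
noncomputable def classSpan : Submodule k (FQSym k) := Submodule.span k (Set.range (classSum k))

theorem classSum_mem (σ : SignedPerm) : classSum k σ ∈ classSpan k :=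
  Submodule.subset_span ⟨σ, rfl⟩

theorem classSum_empty : classSum k SignedPerm.empty = 1 := by
  have h : SignedPerm.empty.baxterClass = {SignedPerm.empty} := by
    refine Finset.eq_singleton_iff_unique_mem.2 ⟨SignedPerm.self_mem_baxterClass _, fun τ h => ?_⟩
    exact τ.eq_empty_of_size (SignedPerm.size_of_mem_baxterClass h)
  rw [classSum, h, Finset.sum_singleton, one_def]

theorem one_mem_classSpan : (1 : FQSym k) ∈ classSpan k := by
  rw [← classSum_empty]
  exact classSum_mem _

/-- All members of a class have the same size, so a shifted shuffle determines its two factors. The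
product is thus a sum without multiplicities over a set that is a union of classes. -/
theorem classSum_mul_mem (σ τ : SignedPerm) : classSum k σ * classSum k τ ∈ classSpan k := by
  classical
  have h : classSum k σ * classSum k τ =
      ∑ ρ ∈ (σ.baxterClass ×ˢ τ.baxterClass).biUnion fun p => p.1.shiftedShuffle p.2,
        (1 : k) • F k ρ := by
    rw [Finset.sum_biUnion, classSum, classSum, Finset.sum_mul_sum, ← Finset.sum_product']
    · exact Finset.sum_congr rfl fun p _ => by simp only [F_mul_F, one_smul]
    · rintro ⟨σ₁, τ₁⟩ h1 ⟨σ₂, τ₂⟩ h2 hne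
      refine Finset.disjoint_left.2 fun ρ h3 h4 => hne ?_
      have h1 := (Finset.mem_product.1 (Finset.mem_coe.1 h1)).1
      have h2 := (Finset.mem_product.1 (Finset.mem_coe.1 h2)).1
      have h5 := SignedPerm.filter_of_mem_shiftedShuffle h3
      have h6 := SignedPerm.filter_of_mem_shiftedShuffle h4
      have hs := (SignedPerm.size_of_mem_baxterClass h1).trans
        (SignedPerm.size_of_mem_baxterClass h2).symm
      simp only at h5 h6 hs
      rw [hs] at h5
      exact Prod.ext (SignedPerm.ext (h5.1.symm.trans h6.1))
        (SignedPerm.ext (shiftWord_injective _ (h5.2.symm.trans h6.2)))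
  rw [h]
  refine Submodule.span_mono ?_ (sum_smul_mem_span_classSums SignedPerm.baxterClass
    SignedPerm.self_mem_baxterClass SignedPerm.baxterClass_eq (fun _ => 1) (fun _ _ _ => rfl)
    (F k) _ (SignedPerm.baxterClass_subset_biUnion σ τ))
  rintro _ ⟨ρ, -, rfl⟩
  exact ⟨ρ, rfl⟩

theorem mul_mem_classSpan {x y : FQSym k} (hx : x ∈ classSpan k) (hy : y ∈ classSpan k) :
    x * y ∈ classSpan k := by
  induction hx, hy using Submodule.span_induction₂ with
  | mem_mem x y hx hy =>
    obtain ⟨σ, rfl⟩ := hx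
    obtain ⟨τ, rfl⟩ := hy
    exact classSum_mul_mem σ τ
  | zero_left y _ => rw [zero_mul]; exact zero_mem _
  | zero_right x _ => rw [mul_zero]; exact zero_mem _
  | add_left x y z _ _ _ h1 h2 => rw [add_mul]; exact add_mem h1 h2
  | add_right x y z _ _ _ h1 h2 => rw [mul_add]; exact add_mem h1 h2
  | smul_left r x y _ _ h => rw [smul_mul_assoc]; exact Submodule.smul_mem _ _ h
  | smul_right r x y _ _ h => rw [mul_smul_comm]; exact Submodule.smul_mem _ _ h

/-- The homogeneous parts of the coproduct of a class sum. -/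
theorem sum_cut_mem_span (σ₀ : SignedPerm) (i : ℕ) (hi : i ≤ σ₀.size) :
    ∑ σ ∈ σ₀.baxterClass, F k (σ.take i) ⊗ₜ[k] F k (σ.drop i) ∈
      Submodule.span k {x | ∃ α β : SignedPerm, α.size = i ∧
        x = classSum k α ⊗ₜ[k] classSum k β} := by
  classical
  let f : SignedPerm × SignedPerm → FQSym k ⊗[k] FQSym k := fun p => F k p.1 ⊗ₜ[k] F k p.2
  let g : SignedPerm → SignedPerm × SignedPerm := fun σ => (σ.take i, σ.drop i)
  let S := σ₀.baxterClass.image g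
  let cls : SignedPerm × SignedPerm → Finset (SignedPerm × SignedPerm) :=
    fun p => p.1.baxterClass ×ˢ p.2.baxterClass
  -- The coefficient at a pair `p` is the number of members of the class cut into `p`. The
  -- inequality of `card_cut_le` in both directions makes it constant on products of classes.
  have hle : ∀ p, ∀ q ∈ cls p, (σ₀.baxterClass.filter fun σ => g σ = p).card ≤
      (σ₀.baxterClass.filter fun σ => g σ = q).card := by
    rintro ⟨α, β⟩ ⟨α', β'⟩ h
    rw [Finset.mem_product] at h
    exact SignedPerm.card_cut_le σ₀ i hi (SignedPerm.mem_baxterClass.1 h.1)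
      (SignedPerm.mem_baxterClass.1 h.2)
  have hself : ∀ p, p ∈ cls p := fun p => Finset.mem_product.2
    ⟨SignedPerm.self_mem_baxterClass _, SignedPerm.self_mem_baxterClass _⟩
  have heq : ∀ p, ∀ q ∈ cls p, cls q = cls p := by
    intro p q h
    have h := Finset.mem_product.1 h
    change _ ×ˢ _ = _ ×ˢ _
    rw [SignedPerm.baxterClass_eq _ _ h.1, SignedPerm.baxterClass_eq _ _ h.2]
  have hge : ∀ p, ∀ q ∈ cls p, (σ₀.baxterClass.filter fun σ => g σ = q).card ≤
      (σ₀.baxterClass.filter fun σ => g σ = p).card := fun p q h =>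
    hle q p (heq p q h ▸ hself p)
  -- A positive count stays positive throughout a product of classes.
  have hS : ∀ p ∈ S, cls p ⊆ S := by
    intro p hp q hq
    obtain ⟨σ, hσ, rfl⟩ := Finset.mem_image.1 hp
    have h1 : 0 < (σ₀.baxterClass.filter fun τ => g τ = g σ).card :=
      Finset.card_pos.2 ⟨σ, Finset.mem_filter.2 ⟨hσ, rfl⟩⟩
    obtain ⟨τ, hτ⟩ := Finset.card_pos.1 (h1.trans_le (hle _ _ hq))
    rw [Finset.mem_filter] at hτ
    exact Finset.mem_image.2 ⟨τ, hτ⟩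
  have h := sum_smul_mem_span_classSums (k := k) cls hself heq
    (fun p => ((σ₀.baxterClass.filter fun σ => g σ = p).card : k))
    (fun p q hq => congrArg _ (le_antisymm (hge p q hq) (hle p q hq))) f S hS
  have hsum : ∑ σ ∈ σ₀.baxterClass, F k (σ.take i) ⊗ₜ[k] F k (σ.drop i) =
      ∑ p ∈ S, ((σ₀.baxterClass.filter fun σ => g σ = p).card : k) • f p := by
    change ∑ σ ∈ σ₀.baxterClass, f (g σ) = _
    rw [Finset.sum_comp f g]
    exact Finset.sum_congr rfl fun p _ => (Nat.cast_smul_eq_nsmul k _ _).symm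
  rw [hsum]
  refine Submodule.span_mono ?_ h
  rintro _ ⟨p, hp, rfl⟩
  obtain ⟨σ, hσ, rfl⟩ := Finset.mem_image.1 (Finset.mem_coe.1 hp)
  refine ⟨(g σ).1, (g σ).2, ?_, ?_⟩
  · rw [SignedPerm.size_take, SignedPerm.size_of_mem_baxterClass hσ]
    exact min_eq_left hi
  · rw [classSum, classSum, TensorProduct.sum_tmul]
    simp only [TensorProduct.tmul_sum]
    rw [← Finset.sum_product']

theorem comul_mem_classSpan {x : FQSym k} (hx : x ∈ classSpan k) :
    Coalgebra.comul (R := k) x ∈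
      LinearMap.range (TensorProduct.map (classSpan k).subtype (classSpan k).subtype) := by
  refine Submodule.span_le (p := Submodule.comap (Coalgebra.comul (R := k))
    (LinearMap.range (TensorProduct.map (classSpan k).subtype (classSpan k).subtype))) |>.2 ?_ hx
  rintro _ ⟨σ₀, rfl⟩
  rw [SetLike.mem_coe, Submodule.mem_comap, classSum, map_sum]
  have h : ∀ σ ∈ σ₀.baxterClass, Coalgebra.comul (R := k) (F k σ) =
      ∑ i ∈ Finset.range (σ₀.size + 1), F k (σ.take i) ⊗ₜ[k] F k (σ.drop i) := fun σ hσ => by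
    rw [comul_F, SignedPerm.size_of_mem_baxterClass hσ]
  rw [Finset.sum_congr rfl h, Finset.sum_comm]
  refine Submodule.sum_mem _ fun i hi => ?_
  refine Submodule.span_le.2 ?_ (sum_cut_mem_span σ₀ i (Nat.lt_succ_iff.1 (Finset.mem_range.1 hi)))
  rintro _ ⟨α, β, -, rfl⟩
  exact ⟨⟨_, classSum_mem α⟩ ⊗ₜ ⟨_, classSum_mem β⟩, by simp⟩

theorem antipodeF_eq_sum (σ : SignedPerm) (h : σ.size ≠ 0) : antipodeF k σ =
    -∑ i ∈ Finset.range σ.size, antipodeF k (σ.take i) * F k (σ.drop i) := by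
  rw [antipodeF.eq_def k σ, if_neg h, ← Fin.sum_univ_eq_sum_range
    (fun i => antipodeF k (σ.take i) * F k (σ.drop i))]

/-- The recursion for the antipode involves only prefixes of smaller size. Grouped by the cutting
position `i`, they form class sums of size `i < N`, to which the induction applies. -/
theorem antipodeMap_classSum_mem (σ₀ : SignedPerm) :
    antipodeMap (classSum k σ₀) ∈ classSpan k := by
  induction hN : σ₀.size using Nat.strong_induction_on generalizing σ₀ with
  | _ N ih =>
    by_cases h0 : N = 0
    · rw [σ₀.eq_empty_of_size (hN.trans h0), classSum_empty, one_def, antipodeMap, lift_F,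
        antipodeF.eq_def, if_pos (show SignedPerm.empty.size = 0 from rfl)]
      exact one_mem_classSpan
    · have hF : ∀ σ ∈ σ₀.baxterClass, antipodeMap (F k σ) =
          -∑ i ∈ Finset.range N, (LinearMap.mul' k (FQSym k) ∘ₗ
            TensorProduct.map antipodeMap LinearMap.id) (F k (σ.take i) ⊗ₜ[k] F k (σ.drop i)) := by
        intro σ hσ
        have hs := (SignedPerm.size_of_mem_baxterClass hσ).trans hN
        rw [antipodeMap, lift_F, antipodeF_eq_sum σ (by omega), hs]
        simp
      rw [classSum, map_sum, Finset.sum_congr rfl hF, Finset.sum_neg_distrib, Finset.sum_comm]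
      refine Submodule.neg_mem _ (Submodule.sum_mem _ fun i hi => ?_)
      have hi := Finset.mem_range.1 hi
      rw [← map_sum]
      refine Submodule.span_le (p := Submodule.comap (LinearMap.mul' k (FQSym k) ∘ₗ
        TensorProduct.map antipodeMap LinearMap.id) (classSpan k)) |>.2 ?_
        (sum_cut_mem_span σ₀ i (by omega))
      rintro _ ⟨α, β, hα, rfl⟩
      exact mul_mem_classSpan (ih i hi α hα) (classSum_mem β)

theorem isHopfSubalgebra_classSpan : IsHopfSubalgebra k (classSpan k) where
  one_mem := one_mem_classSpan
  mul_mem _ hx _ hy := mul_mem_classSpan hx hy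
  comul_mem _ hx := comul_mem_classSpan hx
  antipode_mem x hx := by
    refine Submodule.span_le (p := Submodule.comap antipodeMap (classSpan k)) |>.2 ?_ hx
    rintro _ ⟨σ, rfl⟩
    exact antipodeMap_classSum_mem σ

end HopfAlgebra

/-! ### Exchanges of adjacent letters with a witness, in symmetric form. -/

section Exchanges

/-- `v` is obtained from `u` by exchanging two adjacent letters, whose values enclose the value of a
negative letter after them or of a positive letter before them. -/
def Exchange (u v : List Letter) : Prop :=
  ∃ (U W : List Letter) (a b c : Letter), u = U ++ a :: c :: W ∧ v = U ++ c :: a :: W ∧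
    ((a.1 < b.1 ∧ b.1 < c.1) ∨ (c.1 < b.1 ∧ b.1 < a.1)) ∧
    ((b.2 = -1 ∧ b ∈ W) ∨ (b.2 = 1 ∧ b ∈ U))

theorem Exchange.symm {u v : List Letter} (h : Exchange u v) : Exchange v u := by
  obtain ⟨U, W, a, b, c, h1, h2, h3, h4⟩ := h
  exact ⟨U, W, c, b, a, h2, h1, h3.symm, h4⟩

theorem CambrianStep.exchange {u v : List Letter} (h : CambrianStep u v) : Exchange u v := by
  cases h with
  | neg U V W a b c hab hbc hb =>
    exact ⟨U, V ++ b :: W, a, b, c, rfl, rfl, .inl ⟨hab, hbc⟩, .inl ⟨hb, by simp⟩⟩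
  | pos U V W a b c hab hbc hb =>
    exact ⟨U ++ b :: V, W, a, b, c, by simp, by simp, .inl ⟨hab, hbc⟩, .inr ⟨hb, by simp⟩⟩

theorem Exchange.wordCongr {u v : List Letter} (h : Exchange u v) : WordCongr u v := by
  have key : ∀ (U W : List Letter) (a b c : Letter), a.1 < b.1 → b.1 < c.1 →
      ((b.2 = -1 ∧ b ∈ W) ∨ (b.2 = 1 ∧ b ∈ U)) →
      WordCongr (U ++ a :: c :: W) (U ++ c :: a :: W) := by
    rintro U W a b c hab hbc (⟨hb, hm⟩ | ⟨hb, hm⟩)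
    · obtain ⟨V, W, rfl⟩ := List.append_of_mem hm
      exact .rel _ _ (.neg U V W a b c hab hbc hb)
    · obtain ⟨U, V, rfl⟩ := List.append_of_mem hm
      refine .rel _ _ ?_
      simpa using CambrianStep.pos U V W a b c hab hbc hb
  obtain ⟨U, W, a, b, c, rfl, rfl, h3 | h3, h4⟩ := h
  · exact key U W a b c h3.1 h3.2 h4
  · exact (key U W c b a h3.1 h3.2 h4).symm

theorem idxOf_lt_of_swap {U W : List ℕ} {a c i j : ℕ} (hnd : (U ++ a :: c :: W).Nodup)
    (hij : ¬ (i = a ∧ j = c))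
    (h : (U ++ a :: c :: W).idxOf i < (U ++ a :: c :: W).idxOf j) :
    (U ++ c :: a :: W).idxOf i < (U ++ c :: a :: W).idxOf j := by
  have hac : a ≠ c := by
    rintro rfl
    simp [List.nodup_append] at hnd
  have ha : a ∉ U := fun h => by simp [List.nodup_append] at hnd; grind
  have hc : c ∉ U := fun h => by simp [List.nodup_append] at hnd; grind
  have hU : ∀ x, x ∈ U → U.idxOf x < U.length := fun x hx => List.idxOf_lt_length_of_mem hx
  -- An explicit formula for positions, applied to both orders of `a` and `c`, leaves only a
  -- comparison of cases.
  have e : ∀ (a c x : ℕ), a ∉ U → c ∉ U → (U ++ a :: c :: W).idxOf x =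
      if x ∈ U then U.idxOf x else if x = a then U.length else if x = c then U.length + 1 else
        U.length + (W.idxOf x + 2) := by
    intro a c x ha hc
    by_cases hx : x ∈ U
    · rw [List.idxOf_append_of_mem hx, if_pos hx]
    · rw [List.idxOf_append_of_notMem hx, if_neg hx]
      by_cases h1 : x = a
      · subst h1; simp
      · rw [List.idxOf_cons_ne _ (Ne.symm h1), if_neg h1]
        by_cases h2 : x = c
        · subst h2; simp
        · rw [List.idxOf_cons_ne _ (Ne.symm h2), if_neg h2]
  rw [e a c i ha hc, e a c j ha hc] at h
  rw [e c a i hc ha, e c a j hc ha]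
  have := hU i
  have := hU j
  grind

end Exchanges

/-! ### Signatures and relative order of letters. -/

namespace SignedPerm

variable {n : ℕ} {ε : Fin n → ℤˣ}

theorem HasSignature.eq_of_mem {σ : SignedPerm} (h : σ.HasSignature ε) {x : Letter}
    (hx : x ∈ σ.word) : ∃ i : Fin n, x = ((i : ℕ), ε i) := by
  have h1 : x.1 < n := h.1 ▸ σ.lt_size (List.mem_map_of_mem hx)
  exact ⟨⟨x.1, h1⟩, List.inj_on_of_nodup_map σ.nodup hx (h.2 ⟨x.1, h1⟩) rfl⟩

theorem HasSignature.of_perm {σ τ : SignedPerm} (h : σ.HasSignature ε)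
    (hp : σ.word.Perm τ.word) : τ.HasSignature ε :=
  ⟨hp.length_eq.symm.trans h.1, fun i => hp.subset (h.2 i)⟩

theorem HasSignature.mem_values {σ : SignedPerm} (h : σ.HasSignature ε) (i : Fin n) :
    (i : ℕ) ∈ values σ.word :=
  List.mem_map_of_mem (h.2 i)

theorem HasSignature.perm_word {σ τ : SignedPerm} (h : σ.HasSignature ε)
    (h' : τ.HasSignature ε) : σ.word.Perm τ.word := by
  refine (List.perm_ext_iff_of_nodup σ.nodup.of_map τ.nodup.of_map).2 fun x =>
    ⟨fun hx => ?_, fun hx => ?_⟩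
  · obtain ⟨i, rfl⟩ := h.eq_of_mem hx
    exact h'.2 i
  · obtain ⟨i, rfl⟩ := h'.eq_of_mem hx
    exact h.2 i

theorem exists_hasSignature (σ : SignedPerm) :
    ∃ ε : Fin σ.size → ℤˣ, σ.HasSignature ε := by
  have h : ∀ i : Fin σ.size, ∃ s : ℤˣ, ((i : ℕ), s) ∈ σ.word := by
    intro i
    have hi : (i : ℕ) ∈ values σ.word := σ.perm.symm.subset (List.mem_range.2 i.2)
    obtain ⟨x, hx, hxi⟩ := List.mem_map.1 hi
    exact ⟨x.2, by rw [← hxi]; exact hx⟩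
  choose ε hε using h
  exact ⟨ε, rfl, hε⟩

theorem HasSignature.neg {σ : SignedPerm} (h : σ.HasSignature ε) : σ.neg.HasSignature (-ε) := by
  refine ⟨by simpa [size, SignedPerm.neg] using h.1, fun i => ?_⟩
  exact List.mem_map.2 ⟨_, h.2 i, rfl⟩

theorem neg_before {σ : SignedPerm} {i j : ℕ} : σ.neg.Before i j ↔ σ.Before i j := by
  rw [Before, Before, show values σ.neg.word = values σ.word from values_negWord σ.word]

theorem Before.trans {σ : SignedPerm} {i j l : ℕ} (h : σ.Before i j) (h' : σ.Before j l) :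
    σ.Before i l :=
  lt_trans h h'

theorem Before.asymm {σ : SignedPerm} {i j : ℕ} (h : σ.Before i j) : ¬ σ.Before j i :=
  lt_asymm h

theorem before_or_before {σ : SignedPerm} {i j : ℕ} (hi : i ∈ values σ.word) (hij : i ≠ j) :
    σ.Before i j ∨ σ.Before j i :=
  lt_or_gt_of_ne fun h => hij ((List.idxOf_inj hi).1 h)

theorem before_of_append {σ : SignedPerm} {u v : List Letter} (h : σ.word = u ++ v) {x y : Letter}
    (hx : x ∈ u) (hy : y ∈ v) : σ.Before x.1 y.1 := by
  have hv : values σ.word = values u ++ values v := by rw [h]; simp [values]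
  have hnd := hv ▸ σ.nodup
  have hx' : x.1 ∈ values u := List.mem_map_of_mem hx
  have hy' : y.1 ∉ values u := fun h =>
    (List.nodup_append.1 hnd).2.2 _ h _ (List.mem_map_of_mem hy) rfl
  rw [Before, hv, List.idxOf_append_of_mem hx', List.idxOf_append_of_notMem hy']
  exact (List.idxOf_lt_length_of_mem hx').trans_le (Nat.le_add_right _ _)

theorem pairwise_before (σ : SignedPerm) : σ.word.Pairwise fun x y => σ.Before x.1 y.1 := by
  rw [List.pairwise_iff_forall_sublist]
  intro x y hxy
  obtain ⟨u, v, h, hx, hy⟩ : ∃ u v, σ.word = u ++ v ∧ x ∈ u ∧ y ∈ v := by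
    obtain ⟨u, v, h, h1, h2⟩ := List.cons_sublist_iff.1 hxy
    exact ⟨u, v, h, h1, List.singleton_sublist.1 h2⟩
  exact before_of_append h hx hy

end SignedPerm

/-! ### Cambrian classes are the sets of linear extensions of trees. -/

section Extensions

open SignedPerm

variable {n : ℕ} {ε : Fin n → ℤˣ}

theorem before_of_transGen {arc : Fin n → Fin n → Prop} {σ : SignedPerm}
    (hσ : σ ∈ linExt ε arc) {i j : Fin n} (h : Relation.TransGen arc i j) : σ.Before i j := by
  induction h with
  | single h => exact hσ.2 _ _ h
  | tail _ h ih => exact ih.trans (hσ.2 _ _ h)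

/-- An exchange of letters not joined by an arc preserves linear extensions. -/
theorem mem_linExt_of_swap {arc : Fin n → Fin n → Prop} {σ τ : SignedPerm}
    (hσ : σ ∈ linExt ε arc) {U W : List Letter} {a c : Letter} (h : σ.word = U ++ a :: c :: W)
    (h' : τ.word = U ++ c :: a :: W)
    (harc : ∀ i j : Fin n, arc i j → ¬ ((i : ℕ) = a.1 ∧ (j : ℕ) = c.1)) : τ ∈ linExt ε arc := by
  refine ⟨hσ.1.of_perm ?_, fun i j hij => ?_⟩
  · rw [h, h']
    exact (List.Perm.swap c a W).append_left U
  · have h1 := hσ.2 i j hij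
    have hnd := σ.nodup
    rw [h] at hnd
    rw [Before, h] at h1
    rw [Before, h']
    simp only [values, List.map_append, List.map_cons] at h1 hnd ⊢
    exact idxOf_lt_of_swap hnd (harc i j hij) h1

namespace CambrianTree

variable (T : CambrianTree ε)

/-- An arc between the exchanged letters would force a negative witness below one of them, although
it appears after both, or a positive witness above one of them, although it appears before both. -/
theorem mem_linExt_of_exchange {σ τ : SignedPerm} (hσ : σ ∈ linExt ε T.arc)
    (h : Exchange σ.word τ.word) : τ ∈ linExt ε T.arc := by
  obtain ⟨U, W, a, b, c, h1, h2, h3, h4⟩ := h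
  refine mem_linExt_of_swap hσ h1 h2 ?_
  rintro i j hij ⟨hi, hj⟩
  have hb : b ∈ σ.word := by
    rw [h1]
    rcases h4 with h | h <;> simp [h.2]
  obtain ⟨y, rfl⟩ := hσ.1.eq_of_mem hb
  have hadj : (underlying T.arc).Adj i j := T.adj_iff.2 (.inl hij)
  simp only at h3 h4
  rcases h4 with ⟨h4, hm⟩ | ⟨h4, hm⟩
  · have hab : σ.Before i y := by
      have := before_of_append (u := U ++ [a, c]) (v := W) (by simpa using h1) (x := a)
        (by simp) hm
      rwa [← hi] at this
    have hcb : σ.Before j y := by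
      have := before_of_append (u := U ++ [a, c]) (v := W) (by simpa using h1) (x := c)
        (by simp) hm
      rwa [← hj] at this
    have : Relation.TransGen T.arc y i ∨ Relation.TransGen T.arc y j := by
      rcases h3 with h3 | h3
      · exact T.below_of_adj_of_neg hadj (by rw [Fin.lt_def]; omega) (by rw [Fin.lt_def]; omega) h4
      · exact (T.below_of_adj_of_neg hadj.symm (by rw [Fin.lt_def]; omega)
          (by rw [Fin.lt_def]; omega) h4).symm
    rcases this with h | h
    · exact hab.asymm (before_of_transGen hσ h)
    · exact hcb.asymm (before_of_transGen hσ h)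
  · have hab : σ.Before y i := by
      have := before_of_append (u := U) (v := a :: c :: W) h1 hm (y := a) (by simp)
      rwa [← hi] at this
    have hcb : σ.Before y j := by
      have := before_of_append (u := U) (v := a :: c :: W) h1 hm (y := c) (by simp)
      rwa [← hj] at this
    have : Relation.TransGen T.arc i y ∨ Relation.TransGen T.arc j y := by
      rcases h3 with h3 | h3
      · exact T.above_of_adj_of_pos hadj (by rw [Fin.lt_def]; omega) (by rw [Fin.lt_def]; omega) h4
      · exact (T.above_of_adj_of_pos hadj.symm (by rw [Fin.lt_def]; omega)
          (by rw [Fin.lt_def]; omega) h4).symm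
    rcases this with h | h
    · exact hab.asymm (before_of_transGen hσ h)
    · exact hcb.asymm (before_of_transGen hσ h)

theorem mem_linExt_iff_of_wordCongr {u v : List Letter} (h : WordCongr u v) :
    ∀ σ τ : SignedPerm, σ.word = u → τ.word = v →
      (σ ∈ linExt ε T.arc ↔ τ ∈ linExt ε T.arc) := by
  induction h with
  | rel u v h =>
    rintro σ τ rfl rfl
    exact ⟨fun hσ => T.mem_linExt_of_exchange hσ h.exchange,
      fun hτ => T.mem_linExt_of_exchange hτ h.exchange.symm⟩
  | refl u =>
    intro σ τ h h'
    rw [SignedPerm.ext (h.trans h'.symm)]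
  | symm u v _ ih => exact fun σ τ h h' => (ih τ σ h' h).symm
  | trans u v w h _ ih ih' =>
    rintro σ τ rfl rfl
    exact (ih σ (σ.ofPerm v (WordCongr.perm h).symm) rfl rfl).trans (ih' _ τ rfl rfl)

/-- Adjacent letters of a linear extension that another one inverts may be exchanged. -/
theorem exchange_of_inverted {σ τ : SignedPerm} (hσ : σ ∈ linExt ε T.arc)
    (hτ : τ ∈ linExt ε T.arc) {U W : List Letter} {a c : Letter} (h : σ.word = U ++ a :: c :: W)
    (hinv : τ.Before c.1 a.1) : Exchange (U ++ a :: c :: W) (U ++ c :: a :: W) := by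
  obtain ⟨i, hi⟩ := hσ.1.eq_of_mem (x := a) (by simp [h])
  obtain ⟨j, hj⟩ := hσ.1.eq_of_mem (x := c) (by simp [h])
  have hb : σ.Before i j := by
    have := before_of_append (u := U ++ [a]) (v := c :: W) (by simpa using h) (x := a) (y := c)
      (by simp) (by simp)
    rwa [hi, hj] at this
  have hinv' : τ.Before j i := by rwa [hi, hj] at hinv
  have hij : i ≠ j := by
    rintro rfl
    exact hb.asymm hb
  rcases T.comparable_or_separated hij with h1 | h1 | ⟨y, hy, hbet⟩
  · exact (hinv'.asymm (before_of_transGen hτ h1)).elim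
  · exact (hb.asymm (before_of_transGen hσ h1)).elim
  have hyi : (y : ℕ) ≠ i := by omega
  have hyj : (y : ℕ) ≠ j := by omega
  have hmem : ((y : ℕ), ε y) ∈ U ∨ ((y : ℕ), ε y) ∈ W := by
    have := hσ.1.2 y
    rw [h] at this
    simp only [List.mem_append, List.mem_cons, hi, hj, Prod.mk.injEq, hyi, hyj, false_and,
      false_or] at this
    exact this
  refine ⟨U, W, a, (y, ε y), c, rfl, rfl, ?_, ?_⟩
  · rw [hi, hj]
    exact hbet
  · rcases hy with ⟨h1, h2⟩ | ⟨h1, h2⟩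
    · refine .inl ⟨h1, hmem.resolve_left fun hm => ?_⟩
      have := before_of_append (u := U) (v := a :: c :: W) h hm (y := a) (by simp)
      rw [hi] at this
      exact this.asymm (before_of_transGen hσ h2)
    · refine .inr ⟨h1, hmem.resolve_right fun hm => ?_⟩
      have := before_of_append (u := U ++ [a, c]) (v := W) (by simpa using h) (x := a)
        (by simp) hm
      rw [hi] at this
      exact this.asymm (before_of_transGen hσ h2)

open Classical in
-- Bubble sort from `σ` to `τ` within the linear extensions of `T`, by induction on the number of
-- pairs that the two words order differently.
theorem wordCongr_of_mem_linExt {σ τ : SignedPerm} (hσ : σ ∈ linExt ε T.arc)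
    (hτ : τ ∈ linExt ε T.arc) : WordCongr σ.word τ.word := by
  let inv : SignedPerm → Finset (Fin n × Fin n) := fun ρ =>
    Finset.univ.filter fun p => ρ.Before p.1 p.2 ∧ τ.Before p.2 p.1
  induction hN : (inv σ).card using Nat.strong_induction_on generalizing σ with
  | _ N ih =>
    -- If all adjacent letters of `σ` are ordered as in `τ`, then by transitivity all letters are,
    -- and the words agree.
    by_cases hch : σ.word.IsChain fun x y => τ.Before x.1 y.1
    · have : IsTrans Letter fun x y => τ.Before x.1 y.1 := ⟨fun _ _ _ h h' => h.trans h'⟩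
      have heq : σ.word = τ.word := (hσ.1.perm_word hτ.1).eq_of_pairwise
        (fun _ _ _ _ h h' => (h.asymm h').elim) (List.isChain_iff_pairwise.1 hch) τ.pairwise_before
      rw [heq]
      exact .refl _
    · rw [List.isChain_iff_forall_rel_of_append_cons_cons] at hch
      push Not at hch
      obtain ⟨a, c, U, W, h, hnot⟩ := hch
      obtain ⟨i, hi⟩ := hσ.1.eq_of_mem (x := a) (by simp [h])
      obtain ⟨j, hj⟩ := hσ.1.eq_of_mem (x := c) (by simp [h])
      have hb : σ.Before a.1 c.1 :=
        before_of_append (u := U ++ [a]) (v := c :: W) (by simpa using h) (by simp) (by simp)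
      have hac : a.1 ≠ c.1 := by
        intro he
        rw [he] at hb
        exact hb.asymm hb
      have hinv : τ.Before c.1 a.1 := by
        refine (before_or_before ?_ hac).resolve_left hnot
        rw [hi]
        exact hτ.1.mem_values i
      have hex := T.exchange_of_inverted hσ hτ h hinv
      let ρ : SignedPerm := σ.ofPerm (U ++ c :: a :: W) (h ▸ hex.wordCongr.perm.symm)
      have hex' : Exchange σ.word ρ.word := h ▸ hex
      refine hex'.wordCongr.trans (ih _ ?_ (T.mem_linExt_of_exchange hσ hex') rfl)
      rw [← hN]
      -- The exchange creates no new inversion and removes the pair `(i, j)`.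
      refine Finset.card_lt_card (Finset.ssubset_iff_of_subset ?_ |>.2 ⟨(i, j), ?_, ?_⟩)
      · intro p hp
        simp only [inv, Finset.mem_filter, Finset.mem_univ, true_and] at hp ⊢
        refine ⟨?_, hp.2⟩
        have h1 := hp.1
        have hnd := ρ.nodup
        change (values (U ++ c :: a :: W)).Nodup at hnd
        change (values (U ++ c :: a :: W)).idxOf _ < (values (U ++ c :: a :: W)).idxOf _ at h1
        rw [Before, h]
        simp only [values, List.map_append, List.map_cons] at h1 hnd ⊢
        refine idxOf_lt_of_swap hnd ?_ h1
        rintro ⟨e1, e2⟩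
        have h2 := hp.2
        rw [e1, e2] at h2
        exact hinv.asymm h2
      · simp only [inv, Finset.mem_filter, Finset.mem_univ, true_and]
        rw [hi, hj] at hb hinv
        exact ⟨hb, hinv⟩
      · simp only [inv, Finset.mem_filter, Finset.mem_univ, true_and, not_and]
        intro h1
        have h2 : ρ.Before c.1 a.1 := before_of_append (σ := ρ) (u := U ++ [c]) (v := a :: W)
          (by simp [ρ, ofPerm]) (by simp) (by simp)
        rw [hi, hj] at h2
        exact (h2.asymm h1).elim

/-- Linear extensions of one tree are congruent, and congruence does not leave them. -/
theorem linExt_eq_class {σ : SignedPerm} (hσ : σ ∈ linExt ε T.arc) :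
    linExt ε T.arc = {τ | CambrianCongr τ σ} := by
  ext τ
  rw [Set.mem_ofPred_eq, cambrianCongr_iff]
  exact ⟨fun hτ => T.wordCongr_of_mem_linExt hτ hσ,
    fun h => (T.mem_linExt_iff_of_wordCongr h τ σ rfl rfl).2 hσ⟩

end CambrianTree

/-- An acyclic directed graph has a linear extension. -/
theorem linExt_nonempty (ε : Fin n → ℤˣ) (arc : Fin n → Fin n → Prop)
    (h : ∀ i, ¬ Relation.TransGen arc i i) : (linExt ε arc).Nonempty := by
  classical
  have : IsPartialOrder (Fin n) (Relation.ReflTransGen arc) :=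
    { refl := fun _ => .refl
      trans := fun _ _ _ => .trans
      antisymm := fun i j hij hji => by
        rcases Relation.reflTransGen_iff_eq_or_transGen.1 hij with he | h1
        · exact he.symm
        · exact (h i (h1.trans_left hji)).elim }
  -- The reachability order is extended to a total order, along which the labels are sorted.
  obtain ⟨s, hs, hle⟩ := extend_partialOrder (Relation.ReflTransGen arc)
  let l := Finset.univ.sort s
  have hmem : ∀ i, i ∈ l := fun i => (Finset.mem_sort s).2 (Finset.mem_univ i)
  have hnd : l.Nodup := Finset.sort_nodup _ s
  have hlen : l.length = n := by simp [l]
  have hv : values (l.map fun i : Fin n => ((i : ℕ), ε i)) = l.map Fin.val := by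
    simp [values, Function.comp_def]
  let σ : SignedPerm := ⟨l.map fun i : Fin n => ((i : ℕ), ε i), by
    rw [hv, List.length_map, hlen]
    refine (List.perm_ext_iff_of_nodup (hnd.map Fin.val_injective) List.nodup_range).2 fun x => ?_
    rw [List.mem_map, List.mem_range]
    exact ⟨fun ⟨i, _, hi⟩ => hi ▸ i.2, fun hx => ⟨⟨x, hx⟩, hmem _, rfl⟩⟩⟩
  have hsig : σ.HasSignature ε :=
    ⟨by simp [size, σ, hlen], fun i => List.mem_map.2 ⟨i, hmem i, rfl⟩⟩
  refine ⟨σ, hsig, fun i j hij => ?_⟩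
  have hne : (i : ℕ) ≠ j := by
    intro he
    obtain rfl := Fin.ext he
    exact h i (.single hij)
  refine (before_or_before (hsig.mem_values i) hne).resolve_right fun hji => hne ?_
  have hp : (values σ.word).Pairwise fun x y =>
      ∀ a b : Fin n, (a : ℕ) = x → (b : ℕ) = y → s a b := by
    change (values (l.map _)).Pairwise _
    rw [hv]
    refine List.pairwise_map.2 ((Finset.pairwise_sort _ s).imp fun {x y} hxy a b ha hb => ?_)
    rwa [Fin.ext ha, Fin.ext hb]
  have hjs := List.pairwise_iff_getElem.1 hp _ _
    (List.idxOf_lt_length_of_mem (hsig.mem_values j))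
    (List.idxOf_lt_length_of_mem (hsig.mem_values i)) hji j i
    (List.getElem_idxOf _).symm (List.getElem_idxOf _).symm
  exact congrArg Fin.val (antisymm (hle i j (.single hij)) hjs)

/-- With positions in the word as heights, every arc of `strandTree` goes up, that is, respects the
order of the word. -/
theorem exists_tree (σ : SignedPerm) (hσ : σ.HasSignature ε) :
    ∃ T : CambrianTree ε, σ ∈ linExt ε T.arc := by
  have hpos : Function.Injective fun i : Fin n => ((values σ.word).idxOf (i : ℕ) : ℤ) := by
    intro i j hij
    exact Fin.ext ((List.idxOf_inj (hσ.mem_values i)).1 (Nat.cast_injective hij))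
  exact ⟨strandTree ε hpos, hσ, fun i j hij => by exact_mod_cast hij.lt⟩

end Extensions

/-! ### Twin trees and Baxter-Cambrian classes. -/

section Twins

open SignedPerm

variable {n : ℕ} {ε : Fin n → ℤˣ}

namespace CambrianTree

/-- Changing signs moves no letter, so the arcs coming from `T'` can be tested on `σ.neg`. -/
theorem linExt_unionArc (T T' : CambrianTree ε) : linExt ε (T.unionArc T') =
    linExt ε T.arc ∩ SignedPerm.neg ⁻¹' linExt (-ε) T'.reverse.arc := by
  ext σ
  constructor
  · exact fun h => ⟨⟨h.1, fun i j hij => h.2 i j (.inl hij)⟩,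
      h.1.neg, fun i j hij => neg_before.2 (h.2 i j (.inr hij))⟩
  · rintro ⟨h, h'⟩
    refine ⟨h.1, fun i j hij => ?_⟩
    rcases hij with hij | hij
    · exact h.2 i j hij
    · exact neg_before.1 (h'.2 i j hij)

theorem twin_of_mem_linExt {T T' : CambrianTree ε} {σ : SignedPerm}
    (hσ : σ ∈ linExt ε (T.unionArc T')) : T.Twin T' := fun _ h =>
  (before_of_transGen hσ h).asymm (before_of_transGen hσ h)

theorem isCambrianClass_linExt (T : CambrianTree ε) {σ : SignedPerm}
    (hσ : σ ∈ linExt ε T.arc) : IsCambrianClass ε (linExt ε T.arc) :=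
  ⟨σ, hσ.1, T.linExt_eq_class hσ⟩

/-- The reverse of `S` has signature `-(-ε)`, which equals `ε` only propositionally; hence the
transport, and an equality of arcs rather than of trees. -/
theorem exists_reverse (S : CambrianTree (-ε)) : ∃ T : CambrianTree ε, T.reverse.arc = S.arc := by
  have key : ∀ {ε' : Fin n → ℤˣ}, ε' = ε → ∀ R : CambrianTree ε',
      ∃ T : CambrianTree ε, T.arc = R.arc := by
    rintro _ rfl R
    exact ⟨R, rfl⟩
  obtain ⟨T, hT⟩ := key (neg_neg ε) S.reverse
  refine ⟨T, ?_⟩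
  funext v w
  change T.arc w v = S.arc v w
  rw [hT]
  rfl

theorem linExt_unionArc_eq_baxterClass (T T' : CambrianTree ε) {σ : SignedPerm}
    (hσ : σ ∈ linExt ε (T.unionArc T')) : linExt ε (T.unionArc T') = σ.baxterClass := by
  rw [linExt_unionArc] at hσ ⊢
  rw [T.linExt_eq_class hσ.1, T'.reverse.linExt_eq_class hσ.2]
  ext τ
  rw [Finset.mem_coe, mem_baxterClass]
  exact and_congr cambrianCongr_iff cambrianCongr_iff

end CambrianTree

/-- One tree comes from `σ`, the other is the reverse of a tree for `σ.neg`. Having `σ` as a common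
linear extension already makes them twin. -/
theorem exists_twin_trees (σ : SignedPerm) (hσ : σ.HasSignature ε) :
    ∃ T T' : CambrianTree ε, σ ∈ linExt ε (T.unionArc T') := by
  obtain ⟨T, hT⟩ := exists_tree σ hσ
  obtain ⟨S, hS⟩ := exists_tree σ.neg hσ.neg
  obtain ⟨T', hT'⟩ := S.exists_reverse
  refine ⟨T, T', ?_⟩
  rw [T.linExt_unionArc, hT']
  exact ⟨hT, hS⟩

theorem IsCambrianClass.eq_linExt {C : Set SignedPerm} (hC : IsCambrianClass ε C)
    (T : CambrianTree ε) {σ : SignedPerm} (hσ : σ ∈ linExt ε T.arc) (hσC : σ ∈ C) :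
    C = linExt ε T.arc := by
  obtain ⟨τ, -, rfl⟩ := hC
  rw [T.linExt_eq_class hσ]
  ext ρ
  exact ⟨fun h => .trans _ _ _ h (.symm _ _ hσC), fun h => .trans _ _ _ h hσC⟩

theorem IsCambrianClass.hasSignature {C : Set SignedPerm} (hC : IsCambrianClass ε C)
    {σ : SignedPerm} (hσ : σ ∈ C) : σ.HasSignature ε := by
  obtain ⟨τ, hτ, rfl⟩ := hC
  exact hτ.of_perm (cambrianCongr_iff.1 hσ).perm.symm

/-- The two spanning sets coincide: a twin pair has a linear extension `σ` and its sum runs over the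
class of `σ`, while each `σ` comes from a twin pair. -/
theorem baxCamb_eq_classSpan (k : Type*) [CommRing k] : BaxCamb k = classSpan k := by
  have hP : ∀ {n : ℕ} {ε : Fin n → ℤˣ} (T T' : CambrianTree ε) {σ : SignedPerm},
      σ ∈ linExt ε (T.unionArc T') → PBax k T T' = classSum k σ := by
    intro n ε T T' σ hσ
    refine Finset.sum_congr (Finset.coe_injective ?_) fun _ _ => rfl
    rw [Set.Finite.coe_toFinset, T.linExt_unionArc_eq_baxterClass T' hσ]
  refine congrArg (Submodule.span k) (Set.ext fun x => ⟨?_, ?_⟩)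
  · rintro ⟨n, ε, T, T', hT, rfl⟩
    obtain ⟨σ, hσ⟩ := linExt_nonempty ε _ hT
    exact ⟨σ, (hP T T' hσ).symm⟩
  · rintro ⟨σ, rfl⟩
    obtain ⟨ε, hε⟩ := σ.exists_hasSignature
    obtain ⟨T, T', hσ⟩ := exists_twin_trees σ hε
    exact ⟨_, ε, T, T', CambrianTree.twin_of_mem_linExt hσ, (hP T T' hσ).symm⟩

end Twins

end BaxterCambrian

open BaxterCambrian
theorem mainTheorem11 (k : Type*) [Field k] :
    IsHopfSubalgebra k (BaxCamb k) ∧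
    (∀ (n : ℕ) (ε : Fin n → ℤˣ) (T T' : CambrianTree ε), T.Twin T' →
      (linExt ε (T.unionArc T')).Nonempty ∧
      IsCambrianClass ε (linExt ε T.arc) ∧
      IsCambrianClass (-ε) (linExt (-ε) T'.reverse.arc) ∧
      linExt ε (T.unionArc T') =
        linExt ε T.arc ∩ SignedPerm.neg ⁻¹' linExt (-ε) T'.reverse.arc) ∧
    (∀ (n : ℕ) (ε : Fin n → ℤˣ) (C D : Set SignedPerm),
      IsCambrianClass ε C → IsCambrianClass (-ε) D → (C ∩ SignedPerm.neg ⁻¹' D).Nonempty →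
      ∃ T T' : CambrianTree ε, T.Twin T' ∧
        linExt ε (T.unionArc T') = C ∩ SignedPerm.neg ⁻¹' D) := by
  refine ⟨?_, fun n ε T T' hT => ?_, fun n ε C D hC hD => ?_⟩
  · rw [baxCamb_eq_classSpan]
    exact isHopfSubalgebra_classSpan
  · have hne := linExt_nonempty ε _ hT
    have heq := T.linExt_unionArc T'
    refine ⟨hne, ?_, ?_, heq⟩
    · obtain ⟨σ, hσ⟩ := hne
      exact T.isCambrianClass_linExt (heq ▸ hσ).1
    · obtain ⟨σ, hσ⟩ := hne
      exact T'.reverse.isCambrianClass_linExt (heq ▸ hσ).2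
  -- The trees built from a common element `σ` have linear extensions meeting `C` and `D`, and
  -- classes that meet are equal.
  · rintro ⟨σ, hσC, hσD⟩
    obtain ⟨T, T', hσ⟩ := exists_twin_trees σ (hC.hasSignature hσC)
    refine ⟨T, T', CambrianTree.twin_of_mem_linExt hσ, ?_⟩
    rw [T.linExt_unionArc T'] at hσ ⊢
    rw [hC.eq_linExt T hσ.1 hσC, hD.eq_linExt T'.reverse hσ.2 hσD]
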